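/- Let $\mathbb{K}$ be a field of characteristic zero and $G$ a finite group. Let $R(G)=R_{\mathbb{K}}(G)$ be the ring of virtual characters of $G$ over $\mathbb{K}$, i.e. the Grothendieck ring of finite-dimensional $\mathbb{K}G$-modules, with augmentation $\epsilon\colon R(G)\to\mathbb{Z}$ (the degree) and with the operations $\lambda^n$ determined by $\lambda^n([V])=[\Lambda^n V]$ and $\lambda^n(x+y)=\sum_{i+j=n}\lambda^i(x)\lambda^j(y)$, $\lambda^0=1$. Put $\gamma^n(x)=\lambda^n(x+n-1)$. The Grothendieck filtration $\{\Gamma^n(G)\}_{n\ge 0}$ is defined as follows: $\Gamma^n(G)$ is the additive subgroup of $R(G)$ generated by the monomials $\gamma^{n_1}(x_1)\cdots\gamma^{n_k}(x_k)$ with $\epsilon(x_i)=0$ for all $i$ and $\sum_i n_i\ge n$. The saturated filtration is $$F^n(G)=\sum_{H\le G}\mathrm{Ind}_H^G(\Gamma^n(H)),\qquad n\ge 0 .$$ Then the filtrations $\{F^n(G)\}$ and $\{\Gamma^n(G)\}$ define the same topology on $R(G)$ (the group topologies in which the $F^n(G)$, respectively the $\Gamma^n(G)$, form a basis of neighbourhoods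 of $0$). Consequently, for every subgroup $H\le G$, the induction map $\mathrm{Ind}_H^G\colon R(H)\to R(G)$ is continuous for the topologies defined by the Grothendieck filtrations, and it extends (uniquely) to a continuous homomorphism of additive groups $\widehat{\mathrm{Ind}}_H^G\colon\widehat{R}(H)\to\widehat{R}(G)$ between the completions for these topologies. -/

import Mathlib

universe u v w w'

namespace VirtualChar

open CategoryTheory MonoidalCategory

section

variable {K : Type u} [Field K] {G : Type v} [Group G]

/-- The representation underlying an object of `FDRep K G`. -/
noncomputable abbrev rep (V : FDRep K G) : Representation K G V := V.ρ

/-- The representation `ρ` written in coordinates with respect to a basis. -/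
noncomputable def coordRep {V : Type w} [AddCommGroup V] [Module K V] [Module.Finite K V]
    (ρ : Representation K G V) : Representation K G (Fin (Module.finrank K V) → K) :=
  (Module.finBasis K V).equivFun.conjRingEquiv.toRingHom.toMonoidHom.comp ρ

variable (K G) in
/-- The elements `[V ⊕ W] - [V] - [W]`, for finite-dimensional representations `V`, `W`. -/
def charRelations : Set (FreeAbelianGroup (Skeleton (FDRep K G))) :=
  {x | ∃ V W : FDRep K G, x = .of (toSkeleton (FDRep.of ((rep V).prod (rep W))))
    - .of (toSkeleton V) - .of (toSkeleton W)}

variable (K G) in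
/-- The ring `R_K(G)` of virtual characters: the Grothendieck ring of finite-dimensional
representations. The free abelian group on isomorphism classes, with the product given by `⊗`, is
divided by the relations `[V ⊕ W] = [V] + [W]`. They are stable under multiplication by classes
`[U]`, hence the ideal that they span is the additive subgroup that they span. -/
def CharRing : Type (max (u+1) v) :=
  FreeAbelianGroup (Skeleton (FDRep K G)) ⧸ Ideal.span (charRelations K G)

noncomputable instance : CommRing (CharRing K G) :=
  inferInstanceAs (CommRing
    (FreeAbelianGroup (Skeleton (FDRep K G)) ⧸ Ideal.span (charRelations K G)))

variable (K G) in
/-- The projection from the free abelian group on isomorphism classes of representations. -/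
noncomputable def CharRing.mk : FreeAbelianGroup (Skeleton (FDRep K G)) →+* CharRing K G :=
  Ideal.Quotient.mk _

theorem CharRing.mk_surjective : Function.Surjective (CharRing.mk K G) :=
  Ideal.Quotient.mk_surjective

theorem CharRing.mk_eq_iff {x y : FreeAbelianGroup (Skeleton (FDRep K G))} :
    CharRing.mk K G x = CharRing.mk K G y ↔ x - y ∈ Ideal.span (charRelations K G) :=
  Ideal.Quotient.eq

/-- The class in `R_K(G)` of a finite-dimensional representation, on a space in any universe. -/
noncomputable def repClass {V : Type w} [AddCommGroup V] [Module K V] [Module.Finite K V]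
    (ρ : Representation K G V) : CharRing K G :=
  CharRing.mk K G (.of (toSkeleton (FDRep.of (coordRep ρ))))

/-- A representation is isomorphic to its form in coordinates. -/
noncomputable def coordEquiv {V : Type w} [AddCommGroup V] [Module K V] [Module.Finite K V]
    (ρ : Representation K G V) : ρ.Equiv (coordRep ρ) :=
  .mk (Module.finBasis K V).equivFun fun g => by
    ext x : 1
    simp [coordRep]

/-- Equivalent representations are isomorphic objects of `FDRep K G`. -/
noncomputable def isoOfEquiv {V W : FDRep K G} (e : (rep V).Equiv (rep W)) : V ≅ W :=
  Action.mkIso (LinearEquiv.toFGModuleCatIso (V := V) (W := W) e.toLinearEquiv) fun g => by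
    ext x
    exact e.toIntertwiningMap.isIntertwining _ _ g x

/-- Isomorphic objects of `FDRep K G` are equivalent representations. -/
noncomputable def equivOfIso {V W : FDRep K G} (e : V ≅ W) : (rep V).Equiv (rep W) :=
  .mk (FDRep.isoToLinearEquiv e) fun g => by
    ext x
    have := FDRep.Iso.conj_ρ e g
    simp [rep, this, LinearEquiv.conj_apply]


theorem toSkeleton_eq {V W : FDRep K G} (e : (rep V).Equiv (rep W)) :
    toSkeleton V = toSkeleton W := Quotient.sound ⟨isoOfEquiv e⟩

section classes
variable {V : Type w} [AddCommGroup V] [Module K V] [Module.Finite K V]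
  {W : Type w'} [AddCommGroup W] [Module K W] [Module.Finite K W]
  (ρ : Representation K G V) (σ : Representation K G W)

theorem repClass_rep (V : FDRep K G) :
    repClass (rep V) = CharRing.mk K G (.of (toSkeleton V)) := by
  rw [repClass, toSkeleton_eq (V := V) (W := FDRep.of (coordRep (rep V))) (coordEquiv (rep V))]

variable {ρ σ} in
theorem repClass_congr (e : ρ.Equiv σ) : repClass ρ = repClass σ := by
  rw [repClass, repClass, toSkeleton_eq (V := FDRep.of (coordRep ρ)) (W := FDRep.of (coordRep σ))
    (((coordEquiv ρ).symm.trans e).trans (coordEquiv σ))]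

variable {ρ σ} in
/-- Direct sums of isomorphic representations are isomorphic. -/
noncomputable def prodCongr {V' : Type*} [AddCommGroup V'] [Module K V']
    {W' : Type*} [AddCommGroup W'] [Module K W'] {ρ' : Representation K G V'}
    {σ' : Representation K G W'} (e : ρ.Equiv ρ') (f : σ.Equiv σ') :
    (ρ.prod σ).Equiv (ρ'.prod σ') :=
  .mk (e.toLinearEquiv.prodCongr f.toLinearEquiv) fun g => by
    ext x
    · exact e.toIntertwiningMap.isIntertwining _ _ g x
    · simp
    · simp
    · exact f.toIntertwiningMap.isIntertwining _ _ g x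

variable {ρ σ} in
/-- Tensor products of isomorphic representations are isomorphic. -/
noncomputable def tprodCongr {V' : Type*} [AddCommGroup V'] [Module K V']
    {W' : Type*} [AddCommGroup W'] [Module K W'] {ρ' : Representation K G V'}
    {σ' : Representation K G W'} (e : ρ.Equiv ρ') (f : σ.Equiv σ') :
    (ρ.tprod σ).Equiv (ρ'.tprod σ') :=
  .mk (TensorProduct.congr e.toLinearEquiv f.toLinearEquiv)
    (e.toIntertwiningMap.tensor f.toIntertwiningMap).isIntertwining'

theorem repClass_prod : repClass (ρ.prod σ) = repClass ρ + repClass σ := by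
  rw [repClass_congr (prodCongr (coordEquiv ρ) (coordEquiv σ)), repClass_congr (coordEquiv ρ),
    repClass_congr (coordEquiv σ)]
  have h := repClass_rep (FDRep.of ((coordRep ρ).prod (coordRep σ)))
  have h1 := repClass_rep (FDRep.of (coordRep ρ))
  have h2 := repClass_rep (FDRep.of (coordRep σ))
  simp only [rep, FDRep.of_ρ'] at h h1 h2
  erw [h, h1, h2]
  rw [← map_add, CharRing.mk_eq_iff, ← sub_sub]
  exact Ideal.subset_span ⟨FDRep.of (coordRep ρ), FDRep.of (coordRep σ), rfl⟩

theorem repClass_tprod : repClass (ρ.tprod σ) = repClass ρ * repClass σ := by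
  rw [repClass_congr (tprodCongr (coordEquiv ρ) (coordEquiv σ)), repClass_congr (coordEquiv ρ),
    repClass_congr (coordEquiv σ)]
  have h := repClass_rep (FDRep.of (coordRep ρ) ⊗ FDRep.of (coordRep σ))
  have h1 := repClass_rep (FDRep.of (coordRep ρ))
  have h2 := repClass_rep (FDRep.of (coordRep σ))
  rw [Skeleton.toSkeleton_tensorObj, FreeAbelianGroup.of_mul, map_mul, ← h1, ← h2] at h
  exact h

end classes

theorem repClass_trivial : repClass (Representation.trivial K G K) = 1 :=
  repClass_rep (𝟙_ (FDRep K G))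

theorem CharRing.induction {P : CharRing K G → Prop} (hrep : ∀ V : FDRep K G, P (repClass (rep V)))
    (hneg : ∀ x, P x → P (-x)) (hadd : ∀ x y, P x → P y → P (x + y)) (x : CharRing K G) : P x := by
  obtain ⟨x, rfl⟩ := CharRing.mk_surjective x
  have h1 : ∀ X : Skeleton (FDRep K G), P (CharRing.mk K G (.of X)) := fun X => by
    obtain ⟨V, rfl⟩ := Quotient.exists_rep X
    exact repClass_rep V ▸ hrep V
  induction x using FreeAbelianGroup.induction_on with
  | zero =>
    have := hadd _ _ (h1 1) (hneg _ (h1 1))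
    rwa [add_neg_cancel, ← map_zero (CharRing.mk K G)] at this
  | of X => exact h1 X
  | neg X h => exact hneg _ h
  | add x y hx hy => exact hadd _ _ hx hy

/-- Distributivity of `⊗` over `⊕`. -/
noncomputable def tprodProdEquiv {U : Type*} [AddCommGroup U] [Module K U]
    {V : Type*} [AddCommGroup V] [Module K V] {W : Type*} [AddCommGroup W] [Module K W]
    (τ : Representation K G U) (ρ : Representation K G V) (σ : Representation K G W) :
    (τ.tprod (ρ.prod σ)).Equiv ((τ.tprod ρ).prod (τ.tprod σ)) :=
  .mk (TensorProduct.prodRight K K U V W) fun g => by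
    ext <;> simp

theorem eq_zero_of_mem_span {A : Type*} [AddCommGroup A]
    (φ : FreeAbelianGroup (Skeleton (FDRep K G)) →+ A)
    (hadd : ∀ V W : FDRep K G, φ (.of (toSkeleton (FDRep.of ((rep V).prod (rep W))))) =
      φ (.of (toSkeleton V)) + φ (.of (toSkeleton W)))
    {x : FreeAbelianGroup (Skeleton (FDRep K G))} (hx : x ∈ Ideal.span (charRelations K G)) :
    φ x = 0 := by
  have key : ∀ (a : FreeAbelianGroup (Skeleton (FDRep K G))), ∀ y ∈ charRelations K G,
      φ (a * y) = 0 := by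
    rintro a _ ⟨V, W, rfl⟩
    induction a using FreeAbelianGroup.induction_on with
    | zero => rw [zero_mul, map_zero]
    | of X =>
      obtain ⟨U, rfl⟩ : ∃ U, toSkeleton U = X := Quotient.exists_rep X
      have h : toSkeleton (U ⊗ FDRep.of ((rep V).prod (rep W))) =
          toSkeleton (FDRep.of ((rep (U ⊗ V)).prod (rep (U ⊗ W)))) :=
        toSkeleton_eq (tprodProdEquiv (rep U) (rep V) (rep W))
      rw [mul_sub, mul_sub, ← FreeAbelianGroup.of_mul, ← FreeAbelianGroup.of_mul,
        ← FreeAbelianGroup.of_mul, ← Skeleton.toSkeleton_tensorObj,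
        ← Skeleton.toSkeleton_tensorObj, ← Skeleton.toSkeleton_tensorObj, h, map_sub, map_sub,
        hadd]
      abel
    | neg X h => rw [neg_mul, map_neg, h, neg_zero]
    | add x y hx hy => rw [add_mul, map_add, hx, hy, add_zero]
  suffices ∀ a, φ (a * x) = 0 by simpa using this 1
  induction hx using Submodule.span_induction with
  | mem y hy => exact fun a => key a y hy
  | zero => simp
  | add y z _ _ hy hz => intro a; rw [mul_add, map_add, hy, hz, add_zero]
  | smul b y _ hy => intro a; rw [smul_eq_mul, ← mul_assoc]; exact hy _

/-- An isomorphism invariant of representations, as a function on isomorphism classes. -/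
noncomputable def skelLift {A : Type*} (f : FDRep K G → A)
    (hf : ∀ V W : FDRep K G, (rep V).Equiv (rep W) → f V = f W) : Skeleton (FDRep K G) → A :=
  Quotient.lift (s := isIsomorphicSetoid (FDRep K G)) f fun V W h =>
    hf V W (equivOfIso (Classical.choice (show Nonempty (V ≅ W) from h)))

/-- An additive invariant of representations extends to a homomorphism on `CharRing K G`. -/
noncomputable def CharRing.lift {A : Type*} [AddCommGroup A] (f : FDRep K G → A)
    (hf : ∀ V W : FDRep K G, (rep V).Equiv (rep W) → f V = f W)
    (hadd : ∀ V W : FDRep K G, f (FDRep.of ((rep V).prod (rep W))) = f V + f W) :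
    CharRing K G →+ A :=
  QuotientAddGroup.lift (Ideal.span (charRelations K G)).toAddSubgroup
    (FreeAbelianGroup.lift (skelLift f hf)) fun _ hx =>
    eq_zero_of_mem_span _ (fun V W => by
      rw [FreeAbelianGroup.lift_apply_of, FreeAbelianGroup.lift_apply_of,
        FreeAbelianGroup.lift_apply_of]
      exact hadd V W) hx

theorem CharRing.lift_rep {A : Type*} [AddCommGroup A] (f : FDRep K G → A)
    (hf : ∀ V W : FDRep K G, (rep V).Equiv (rep W) → f V = f W)
    (hadd : ∀ V W : FDRep K G, f (FDRep.of ((rep V).prod (rep W))) = f V + f W) (V : FDRep K G) :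
    CharRing.lift f hf hadd (repClass (rep V)) = f V := by
  rw [repClass_rep]
  exact FreeAbelianGroup.lift_apply_of _ _

variable (K G) in
/-- The augmentation, sending a virtual character to its degree. -/
noncomputable def augmentation : CharRing K G →+* ℤ :=
  let ε : CharRing K G →+ ℤ := CharRing.lift (fun V => (Module.finrank K V : ℤ))
    (fun _ _ e => by rw [e.toLinearEquiv.finrank_eq])
    (fun V W => by
      change ((Module.finrank K (V × W) : ℕ) : ℤ) = _
      rw [Module.finrank_prod, Nat.cast_add])
  have hε : ∀ V : FDRep K G, ε (repClass (rep V)) = Module.finrank K V :=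
    fun V => CharRing.lift_rep _ _ _ V
  { ε with
    map_one' := by
      rw [← repClass_trivial]
      exact (hε (𝟙_ (FDRep K G))).trans (by
        change ((Module.finrank K K : ℕ) : ℤ) = 1
        rw [Module.finrank_self, Nat.cast_one])
    map_mul' := fun x y => by
      change ε (x * y) = ε x * ε y
      induction x using CharRing.induction with
      | hneg x hx => rw [neg_mul, map_neg, hx, map_neg, neg_mul]
      | hadd x z hx hz => rw [add_mul, map_add, hx, hz, map_add, add_mul]
      | hrep V =>
        induction y using CharRing.induction with
        | hneg x hx => rw [mul_neg, map_neg, hx, map_neg, mul_neg]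
        | hadd x z hx hz => rw [mul_add, map_add, hx, hz, map_add, mul_add]
        | hrep W =>
          rw [← repClass_tprod, hε, hε]
          refine (hε (V ⊗ W)).trans ?_
          change ((Module.finrank K (TensorProduct K V W) : ℕ) : ℤ) = _
          rw [Module.finrank_tensorProduct, Nat.cast_mul] }

section piRep

/-- The direct sum of a finite family of representations. -/
def piRep {ι : Type*} {V : ι → Type*} [∀ i, AddCommGroup (V i)] [∀ i, Module K (V i)]
    (ρ : ∀ i, Representation K G (V i)) : Representation K G (∀ i, V i) where
  toFun g := LinearMap.pi fun i => ρ i g ∘ₗ LinearMap.proj i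
  map_one' := by ext; simp
  map_mul' g h := by ext; simp

theorem repClass_piRep {n : ℕ} {V : Fin n → Type w} [∀ i, AddCommGroup (V i)]
    [∀ i, Module K (V i)] [∀ i, Module.Finite K (V i)] (ρ : ∀ i, Representation K G (V i)) :
    repClass (piRep ρ) = ∑ i, repClass (ρ i) := by
  induction n with
  | zero =>
    have h := repClass_prod (piRep ρ) (piRep ρ)
    have e : (piRep ρ).Equiv ((piRep ρ).prod (piRep ρ)) :=
      .mk 0 fun g => LinearMap.ext fun x => Subsingleton.elim _ _
    rw [← repClass_congr e] at h
    simpa using h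
  | succ n ih =>
    rw [Fin.sum_univ_succ, ← ih, ← repClass_prod]
    exact (repClass_congr (.mk (Fin.consLinearEquiv K V) fun g => by
      apply LinearMap.ext
      rintro ⟨x, y⟩
      funext i
      refine Fin.cases ?_ (fun i => ?_) i <;> simp [piRep])).symm
end piRep

section ext
variable {V : Type w} [AddCommGroup V] [Module K V] {W : Type w'} [AddCommGroup W] [Module K W]

/-- The `n`-th exterior power of a representation. -/
noncomputable def extRep (n : ℕ) (ρ : Representation K G V) : Representation K G (⋀[K]^n V) where
  toFun g := exteriorPower.map n (ρ g)
  map_one' := by rw [map_one, Module.End.one_eq_id, exteriorPower.map_id, Module.End.one_eq_id]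
  map_mul' g h := by rw [map_mul, Module.End.mul_eq_comp, exteriorPower.map_comp]; rfl

/-- Exterior powers of isomorphic representations are isomorphic. -/
noncomputable def extCongr (n : ℕ) {ρ : Representation K G V} {σ : Representation K G W}
    (e : ρ.Equiv σ) : (extRep n ρ).Equiv (extRep n σ) :=
  .mk (LinearEquiv.ofLinearMap (exteriorPower.map n e.toLinearEquiv.toLinearMap)
    (exteriorPower.map n e.toLinearEquiv.symm.toLinearMap)
    (by rw [← exteriorPower.map_comp, LinearEquiv.comp_symm, exteriorPower.map_id])
    (by rw [← exteriorPower.map_comp, LinearEquiv.symm_comp, exteriorPower.map_id])) fun g => by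
      change exteriorPower.map n _ ∘ₗ exteriorPower.map n _ =
        exteriorPower.map n _ ∘ₗ exteriorPower.map n _
      rw [← exteriorPower.map_comp, ← exteriorPower.map_comp]
      exact congrArg _ (e.toIntertwiningMap.isIntertwining' g)

theorem repClass_extRep_zero  [Module.Finite K V] (ρ : Representation K G V) :
    repClass (extRep 0 ρ) = 1 := by
  rw [← repClass_trivial]
  refine repClass_congr (.mk (exteriorPower.zeroEquiv K V) fun g => ?_)
  exact exteriorPower.zeroEquiv_naturality (ρ g)

theorem repClass_extRep_one  [Module.Finite K V] (ρ : Representation K G V) :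
    repClass (extRep 1 ρ) = repClass ρ := by
  refine repClass_congr (.mk (exteriorPower.oneEquiv K V) fun g => ?_)
  exact exteriorPower.oneEquiv_naturality (ρ g)

theorem coe_exteriorPower_map (n : ℕ) (f : V →ₗ[K] W) (x : ⋀[K]^n V) :
    (exteriorPower.map n f x : ExteriorAlgebra K W) = ExteriorAlgebra.map f x := by
  have : (Submodule.subtype _) ∘ₗ exteriorPower.map n f =
      (ExteriorAlgebra.map f).toLinearMap ∘ₗ Submodule.subtype _ := by
    ext v
    simp
  exact LinearMap.congr_fun this x

/-- The product map `⋀ⁱ V ⊗ ⋀ʲ W → ⋀ (V × W)`. -/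
noncomputable def extMul (V : Type w) [AddCommGroup V] [Module K V]
    (W : Type w') [AddCommGroup W] [Module K W] (i j : ℕ) :
    TensorProduct K (⋀[K]^i V) (⋀[K]^j W) →ₗ[K] ExteriorAlgebra K (V × W) :=
  TensorProduct.lift ((LinearMap.mul K (ExteriorAlgebra K (V × W))).compl₁₂
    ((ExteriorAlgebra.map (LinearMap.inl K V W)).toLinearMap ∘ₗ Submodule.subtype _)
    ((ExteriorAlgebra.map (LinearMap.inr K V W)).toLinearMap ∘ₗ Submodule.subtype _))

theorem extMul_tmul (i j : ℕ) (a : ⋀[K]^i V) (b : ⋀[K]^j W) :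
    extMul V W i j (a ⊗ₜ b) = ExteriorAlgebra.map (LinearMap.inl K V W) a *
      ExteriorAlgebra.map (LinearMap.inr K V W) b := rfl

theorem range_ι_comp_pow (f : V →ₗ[K] W) (n : ℕ) :
    LinearMap.range (ExteriorAlgebra.ι K ∘ₗ f) ^ n =
      Submodule.map (ExteriorAlgebra.map f).toLinearMap (⋀[K]^n V) := by
  rw [ExteriorAlgebra.exteriorPower, Submodule.map_pow, ← LinearMap.range_comp,
    ExteriorAlgebra.map_comp_ι]

theorem range_extMul (i j : ℕ) : LinearMap.range (extMul (K := K) V W i j) =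
    LinearMap.range (ExteriorAlgebra.ι K ∘ₗ LinearMap.inl K V W) ^ i *
    LinearMap.range (ExteriorAlgebra.ι K ∘ₗ LinearMap.inr K V W) ^ j := by
  rw [range_ι_comp_pow, range_ι_comp_pow]
  apply le_antisymm
  · rintro _ ⟨x, rfl⟩
    induction x with
    | zero => simp
    | add x y hx hy => rw [map_add]; exact add_mem hx hy
    | tmul a b =>
      exact Submodule.mul_mem_mul ⟨a, a.2, rfl⟩ ⟨b, b.2, rfl⟩
  · rw [Submodule.mul_le]
    rintro _ ⟨a, ha, rfl⟩ _ ⟨b, hb, rfl⟩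
    exact ⟨(⟨a, ha⟩ : ⋀[K]^i V) ⊗ₜ (⟨b, hb⟩ : ⋀[K]^j W), rfl⟩

theorem commute_range_ι : Commute
    (LinearMap.range (ExteriorAlgebra.ι K ∘ₗ LinearMap.inl K V W))
    (LinearMap.range (ExteriorAlgebra.ι K ∘ₗ LinearMap.inr K V W)) := by
  have key : ∀ x y : V × W, ExteriorAlgebra.ι K x * ExteriorAlgebra.ι K y =
      - (ExteriorAlgebra.ι K y * ExteriorAlgebra.ι K x) :=
    fun x y => eq_neg_of_add_eq_zero_left (ExteriorAlgebra.ι_add_mul_swap x y)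
  apply le_antisymm <;> rw [Submodule.mul_le] <;> rintro _ ⟨x, rfl⟩ _ ⟨y, rfl⟩ <;>
    rw [LinearMap.comp_apply, LinearMap.comp_apply, key] <;>
    exact neg_mem (Submodule.mul_mem_mul ⟨_, rfl⟩ ⟨_, rfl⟩)

theorem iSup_range_extMul (n : ℕ) :
    ⨆ i : Fin (n + 1), LinearMap.range (extMul (K := K) V W i (n - i)) = ⋀[K]^n (V × W) := by
  have h : LinearMap.range (ExteriorAlgebra.ι K (M := V × W)) =
      LinearMap.range (ExteriorAlgebra.ι K ∘ₗ LinearMap.inl K V W) +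
      LinearMap.range (ExteriorAlgebra.ι K ∘ₗ LinearMap.inr K V W) := by
    rw [LinearMap.range_comp, LinearMap.range_comp, Submodule.add_eq_sup, ← Submodule.map_sup,
      LinearMap.sup_range_inl_inr, Submodule.map_top]
  have hn : ∀ (m : ℕ) (N : Submodule K (ExteriorAlgebra K (V × W))), m ≠ 0 → m • N = N := by
    intro m N hm
    induction m with
    | zero => exact absurd rfl hm
    | succ k ih =>
      rcases Nat.eq_zero_or_pos k with rfl | hk
      · simp
      · rw [succ_nsmul, ih hk.ne', Submodule.add_eq_sup, sup_idem]
  rw [ExteriorAlgebra.exteriorPower, h, commute_range_ι.add_pow',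
    Finset.Nat.sum_antidiagonal_eq_sum_range_succ_mk, Finset.sum_range]
  simp_rw [range_extMul]
  apply le_antisymm
  · refine iSup_le fun i => ?_
    rw [← hn (n.choose i) (_ * _) (Nat.choose_pos (Nat.lt_succ_iff.mp i.2)).ne']
    exact Finset.single_le_sum (f := fun i : Fin (n + 1) => n.choose i •
      (LinearMap.range (ExteriorAlgebra.ι K ∘ₗ LinearMap.inl K V W) ^ (i : ℕ) *
        LinearMap.range (ExteriorAlgebra.ι K ∘ₗ LinearMap.inr K V W) ^ (n - i)))
      (fun _ _ => bot_le) (Finset.mem_univ i)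
  · refine Finset.sum_induction _ (fun N => N ≤ _) (fun _ _ => sup_le) bot_le fun i _ => ?_
    rw [hn _ _ (Nat.choose_pos (Nat.lt_succ_iff.mp i.2)).ne']
    exact le_iSup (fun i : Fin (n + 1) =>
      LinearMap.range (ExteriorAlgebra.ι K ∘ₗ LinearMap.inl K V W) ^ (i : ℕ) *
        LinearMap.range (ExteriorAlgebra.ι K ∘ₗ LinearMap.inr K V W) ^ (n - i)) i

/-- The sum of the product maps `⋀ⁱ V ⊗ ⋀ⁿ⁻ⁱ W → ⋀ (V × W)`. -/
noncomputable def extSumMap (V : Type w) [AddCommGroup V] [Module K V]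
    (W : Type w') [AddCommGroup W] [Module K W] (n : ℕ) :
    (∀ i : Fin (n + 1), TensorProduct K (⋀[K]^(i : ℕ) V) (⋀[K]^(n - i) W)) →ₗ[K]
      ⋀[K]^n (V × W) :=
  LinearMap.lsum K _ K fun i => (extMul V W i (n - i)).codRestrict _ fun x => by
    rw [← iSup_range_extMul]
    exact Submodule.mem_iSup_of_mem i ⟨x, rfl⟩

theorem extSumMap_single (n : ℕ) (i : Fin (n + 1))
    (x : TensorProduct K (⋀[K]^(i : ℕ) V) (⋀[K]^(n - i) W)) :
    (extSumMap V W n (Pi.single i x) : ExteriorAlgebra K (V × W)) = extMul V W i (n - i) x := by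
  rw [extSumMap, LinearMap.lsum_piSingle]
  rfl

theorem extSumMap_bijective [Module.Finite K V] [Module.Finite K W] (n : ℕ) :
    Function.Bijective (extSumMap (K := K) V W n) := by
  have hs : Function.Surjective (extSumMap (K := K) V W n) := by
    suffices ∀ y ∈ ⋀[K]^n (V × W), ∃ x, (extSumMap (K := K) V W n x : ExteriorAlgebra K (V × W)) = y by
      rintro ⟨y, hy⟩
      obtain ⟨x, hx⟩ := this y hy
      exact ⟨x, Subtype.ext (by exact hx)⟩
    intro y hy
    rw [← iSup_range_extMul] at hy
    induction hy using Submodule.iSup_induction' with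
    | mem i y hy =>
      obtain ⟨x, rfl⟩ := hy
      exact ⟨_, extSumMap_single n i x⟩
    | zero => exact ⟨0, by simp⟩
    | add y z _ _ hy hz =>
      obtain ⟨a, rfl⟩ := hy
      obtain ⟨b, rfl⟩ := hz
      exact ⟨a + b, by simp⟩
  have hd : Module.finrank K (∀ i : Fin (n + 1),
      TensorProduct K (⋀[K]^(i : ℕ) V) (⋀[K]^(n - i) W)) = Module.finrank K (⋀[K]^n (V × W)) := by
    rw [Module.finrank_pi_fintype, exteriorPower.finrank_eq, Module.finrank_prod, Nat.add_choose_eq,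
      Finset.Nat.sum_antidiagonal_eq_sum_range_succ_mk, Finset.sum_range]
    simp [Module.finrank_tensorProduct, exteriorPower.finrank_eq]
  let e := LinearEquiv.ofFinrankEq (R := K) _ _ hd.symm
  have h2 := OrzechProperty.injective_of_surjective_endomorphism
    ((extSumMap (K := K) V W n) ∘ₗ e.toLinearMap) (hs.comp e.surjective)
  refine ⟨fun a b hab => ?_, hs⟩
  obtain ⟨a, rfl⟩ := e.surjective a
  obtain ⟨b, rfl⟩ := e.surjective b
  exact congrArg e (h2 hab)

/-- The decomposition of an exterior power of a direct sum. -/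
noncomputable def extSum [Module.Finite K V] [Module.Finite K W] (n : ℕ)
    (ρ : Representation K G V) (σ : Representation K G W) :
    (piRep (V := fun i : Fin (n + 1) => TensorProduct K (⋀[K]^(i : ℕ) V) (⋀[K]^(n - i) W))
      fun i => (extRep i ρ).tprod (extRep (n - i) σ)).Equiv (extRep n (ρ.prod σ)) :=
  .mk (LinearEquiv.ofBijective (extSumMap V W n) (extSumMap_bijective n)) fun g => by
    refine LinearMap.pi_ext' fun i => TensorProduct.ext' fun a b => Subtype.ext ?_
    have h1 : piRep (V := fun i : Fin (n + 1) => TensorProduct K (⋀[K]^(i : ℕ) V) (⋀[K]^(n - i) W))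
        (fun i => (extRep i ρ).tprod (extRep (n - i) σ)) g (Pi.single i (a ⊗ₜ b)) =
        Pi.single i (exteriorPower.map i (ρ g) a ⊗ₜ exteriorPower.map (n - i) (σ g) b) := by
      funext j
      change ((extRep j ρ).tprod (extRep (n - j) σ)) g ((Pi.single i (a ⊗ₜ[K] b) :
        ∀ i : Fin (n + 1), TensorProduct K (⋀[K]^(i : ℕ) V) (⋀[K]^(n - i) W)) j) = _
      by_cases hj : j = i
      · subst hj
        rw [Pi.single_eq_same, Pi.single_eq_same]
        rfl
      · rw [Pi.single_eq_of_ne hj, Pi.single_eq_of_ne hj, map_zero]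
    change (extSumMap V W n (piRep _ g (Pi.single i (a ⊗ₜ b))) : ExteriorAlgebra K (V × W)) =
      (exteriorPower.map n (ρ.prod σ g) (extSumMap V W n (Pi.single i (a ⊗ₜ b))) :
        ExteriorAlgebra K (V × W))
    rw [h1, extSumMap_single, coe_exteriorPower_map, extSumMap_single, extMul_tmul, extMul_tmul,
      map_mul, coe_exteriorPower_map, coe_exteriorPower_map]
    simp only [← AlgHom.comp_apply, ExteriorAlgebra.map_comp_map]
    have h2 : LinearMap.inl K V W ∘ₗ ρ g = (ρ.prod σ g) ∘ₗ LinearMap.inl K V W := by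
      ext x <;> simp
    have h3 : LinearMap.inr K V W ∘ₗ σ g = (ρ.prod σ g) ∘ₗ LinearMap.inr K V W := by
      ext x <;> simp
    rw [h2, h3]

theorem repClass_extRep_prod [Module.Finite K V] [Module.Finite K W] (n : ℕ)
    (ρ : Representation K G V) (σ : Representation K G W) :
    repClass (extRep n (ρ.prod σ)) = ∑ p ∈ Finset.HasAntidiagonal.antidiagonal n,
      repClass (extRep p.1 ρ) * repClass (extRep p.2 σ) := by
  have h := repClass_piRep
    (V := fun i : Fin (n + 1) => TensorProduct K (⋀[K]^(i : ℕ) V) (⋀[K]^(n - i) W))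
    fun i => (extRep i ρ).tprod (extRep (n - i) σ)
  rw [Finset.Nat.sum_antidiagonal_eq_sum_range_succ_mk, Finset.sum_range]
  simp only [← repClass_tprod]
  exact (repClass_congr (extSum n ρ σ)).symm.trans h

end ext

section lambda

/-- The power series `λ_t(V) = ∑ₙ [⋀ⁿ V] tⁿ` of a representation. -/
noncomputable def lambdaSeries (V : FDRep K G) : PowerSeries (CharRing K G) :=
  .mk fun n => repClass (extRep n (rep V))

theorem isUnit_lambdaSeries (V : FDRep K G) : IsUnit (lambdaSeries V) := by
  rw [PowerSeries.isUnit_iff_constantCoeff, lambdaSeries, ← PowerSeries.coeff_zero_eq_constantCoeff_apply,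
    PowerSeries.coeff_mk, repClass_extRep_zero]
  exact isUnit_one

/-- The homomorphism `x ↦ λ_t(x)` from the additive group `R_K(G)` to the group of invertible power
series over `R_K(G)`, determined by `λ_t([V]) = ∑ₙ [⋀ⁿ V] tⁿ`. -/
noncomputable def lambdaHom : CharRing K G →+ Additive (PowerSeries (CharRing K G))ˣ :=
  CharRing.lift (fun V => .ofMul (isUnit_lambdaSeries V).unit)
    (fun V W e => congrArg Additive.ofMul <| Units.ext <| PowerSeries.ext fun n => by
      simpa [lambdaSeries] using repClass_congr (extCongr n e))
    (fun V W => congrArg Additive.ofMul <| Units.ext <| PowerSeries.ext fun n => by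
      simpa [lambdaSeries, PowerSeries.coeff_mul] using repClass_extRep_prod n (rep V) (rep W))

/-- The operation `λⁿ` on virtual characters. -/
noncomputable def lambdaOp (n : ℕ) (x : CharRing K G) : CharRing K G :=
  PowerSeries.coeff n ((lambdaHom x).toMul : PowerSeries (CharRing K G))

/-- The operation `γⁿ(x) = λⁿ(x + n - 1)`. -/
noncomputable def gammaOp (n : ℕ) (x : CharRing K G) : CharRing K G :=
  lambdaOp n (x + n - 1)

theorem lambdaOp_rep (n : ℕ) (V : FDRep K G) :
    lambdaOp n (repClass (rep V)) = repClass (extRep n (rep V)) := by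
  rw [lambdaOp, lambdaHom, CharRing.lift_rep]
  simp [lambdaSeries]

theorem lambdaOp_add (n : ℕ) (x y : CharRing K G) : lambdaOp n (x + y) =
    ∑ p ∈ Finset.HasAntidiagonal.antidiagonal n, lambdaOp p.1 x * lambdaOp p.2 y := by
  rw [lambdaOp, map_add, toMul_add, Units.val_mul, PowerSeries.coeff_mul]
  rfl

theorem lambdaOp_zero_right (n : ℕ) : lambdaOp n (0 : CharRing K G) = if n = 0 then 1 else 0 := by
  rw [lambdaOp, map_zero, toMul_zero, Units.val_one, PowerSeries.coeff_one]

theorem lambdaOp_zero (x : CharRing K G) : lambdaOp 0 x = 1 := by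
  have h (x y : CharRing K G) : lambdaOp 0 (x + y) = lambdaOp 0 x * lambdaOp 0 y := by
    rw [lambdaOp_add]; simp
  induction x using CharRing.induction with
  | hrep V => rw [lambdaOp_rep, repClass_extRep_zero]
  | hneg x hx =>
    have := h x (-x)
    rwa [add_neg_cancel, lambdaOp_zero_right, if_pos rfl, hx, one_mul, eq_comm] at this
  | hadd x y hx hy => rw [h, hx, hy, one_mul]

theorem lambdaOp_one (x : CharRing K G) : lambdaOp 1 x = x := by
  have h (x y : CharRing K G) : lambdaOp 1 (x + y) = lambdaOp 1 x + lambdaOp 1 y := by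
    rw [lambdaOp_add, Finset.Nat.antidiagonal_succ]
    simp [lambdaOp_zero, add_comm]
  induction x using CharRing.induction with
  | hrep V => rw [lambdaOp_rep, repClass_extRep_one]
  | hneg x hx =>
    have := h x (-x)
    rw [add_neg_cancel, lambdaOp_zero_right, if_neg one_ne_zero, hx] at this
    exact (neg_eq_of_add_eq_zero_right this.symm).symm
  | hadd x y hx hy => rw [h, hx, hy]

theorem gammaOp_one (x : CharRing K G) : gammaOp 1 x = x := by
  rw [gammaOp, lambdaOp_one, Nat.cast_one, add_sub_cancel_right]

variable (K G) in
/-- The monomials `γ^{n₁}(x₁) ⋯ γ^{n_k}(x_k)` with `xᵢ` of augmentation zero and `∑ nᵢ ≥ n`. -/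
def gammaMonomials (n : ℕ) : Set (CharRing K G) :=
  {m | ∃ l : List (ℕ × CharRing K G), (∀ p ∈ l, augmentation K G p.2 = 0) ∧
    n ≤ (l.map fun p => p.1).sum ∧ m = (l.map fun p => gammaOp p.1 p.2).prod}

variable (K G) in
/-- The `n`-th step `Γⁿ` of the Grothendieck filtration. -/
noncomputable def gammaFiltration (n : ℕ) : AddSubgroup (CharRing K G) :=
  AddSubgroup.closure (gammaMonomials K G n)

theorem gammaFiltration_antitone : Antitone (gammaFiltration K G) := fun _ _ h =>
  AddSubgroup.closure_mono fun _ ⟨l, h1, h2, h3⟩ => ⟨l, h1, h.trans h2, h3⟩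

theorem mul_mem_gammaFiltration {m n : ℕ} {x y : CharRing K G} (hx : x ∈ gammaFiltration K G m)
    (hy : y ∈ gammaFiltration K G n) : x * y ∈ gammaFiltration K G (m + n) := by
  induction hx using AddSubgroup.closure_induction with
  | zero => rw [zero_mul]; exact zero_mem _
  | add a b _ _ ha hb => rw [add_mul]; exact add_mem ha hb
  | neg a _ ha => rw [neg_mul]; exact neg_mem ha
  | mem a ha =>
    obtain ⟨l, h1, h2, rfl⟩ := ha
    induction hy using AddSubgroup.closure_induction with
    | zero => rw [mul_zero]; exact zero_mem _
    | add a b _ _ ha hb => rw [mul_add]; exact add_mem ha hb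
    | neg a _ ha => rw [mul_neg]; exact neg_mem ha
    | mem b hb =>
      obtain ⟨l', h1', h2', rfl⟩ := hb
      refine AddSubgroup.subset_closure ⟨l ++ l', fun p hp => ?_, ?_, ?_⟩
      · rcases List.mem_append.1 hp with hp | hp
        exacts [h1 p hp, h1' p hp]
      · simpa using Nat.add_le_add h2 h2'
      · simp

theorem gammaFiltration_zero : gammaFiltration K G 0 = ⊤ := by
  have h1 : (1 : CharRing K G) ∈ gammaFiltration K G 0 :=
    AddSubgroup.subset_closure ⟨[], by simp, by simp, by simp⟩
  rw [eq_top_iff]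
  intro x _
  have hx : x - (augmentation K G x : CharRing K G) ∈ gammaFiltration K G 0 :=
    AddSubgroup.subset_closure ⟨[(1, x - (augmentation K G x : CharRing K G))], by simp,
      by simp, by simp [gammaOp_one]⟩
  have := add_mem hx (zsmul_mem h1 (augmentation K G x))
  simpa using this

end lambda


section induction

variable (H : Subgroup G)

/-- The linear map `K[G] ⊗_{K[H]} V → K[G] ⊗_{K[H]} W` induced by an `H`-equivariant map. -/
noncomputable def indMap {V : Type w} [AddCommGroup V] [Module K V] {W : Type w'} [AddCommGroup W]
    [Module K W] {ρ : Representation K H V} {σ : Representation K H W} (f : ρ.IntertwiningMap σ) :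
    Representation.IndV H.subtype ρ →ₗ[K] Representation.IndV H.subtype σ :=
  Representation.Coinvariants.map _ _ (f.lTensor _)

theorem indMap_mk {V : Type w} [AddCommGroup V] [Module K V] {W : Type w'} [AddCommGroup W]
    [Module K W] {ρ : Representation K H V} {σ : Representation K H W} (f : ρ.IntertwiningMap σ)
    (g : G) (v : V) : indMap H f (Representation.IndV.mk H.subtype ρ g v) =
      Representation.IndV.mk H.subtype σ g (f v) := rfl

theorem indMap_comp_ind {V : Type w} [AddCommGroup V] [Module K V] {W : Type w'} [AddCommGroup W]
    [Module K W] {ρ : Representation K H V} {σ : Representation K H W} (f : ρ.IntertwiningMap σ)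
    (g : G) : indMap H f ∘ₗ Representation.ind H.subtype ρ g =
      Representation.ind H.subtype σ g ∘ₗ indMap H f := by
  refine Representation.IndV.hom_ext _ _ fun a => LinearMap.ext fun v => ?_
  change indMap H f (Representation.ind H.subtype ρ g (Representation.IndV.mk _ _ a v)) =
    Representation.ind H.subtype σ g (indMap H f (Representation.IndV.mk _ _ a v))
  rw [indMap_mk, Representation.ind_mk,
    Representation.ind_mk, indMap_mk]

/-- Isomorphic representations induce isomorphic representations. -/
noncomputable def indCongr {V : Type w} [AddCommGroup V] [Module K V] {W : Type w'}
    [AddCommGroup W] [Module K W] {ρ : Representation K H V} {σ : Representation K H W}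
    (e : ρ.Equiv σ) :
    (Representation.ind H.subtype ρ).Equiv (Representation.ind H.subtype σ) :=
  .mk (LinearEquiv.ofLinearMap (indMap H e.toIntertwiningMap) (indMap H e.symm.toIntertwiningMap)
    (Representation.IndV.hom_ext _ _ fun a => LinearMap.ext fun v =>
      congrArg (Representation.IndV.mk H.subtype σ a) (e.apply_symm_apply v))
    (Representation.IndV.hom_ext _ _ fun a => LinearMap.ext fun v =>
      congrArg (Representation.IndV.mk H.subtype ρ a) (e.symm_apply_apply v)))
    (indMap_comp_ind H e.toIntertwiningMap)

/-- Induction commutes with direct sums. -/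
noncomputable def indProd {V : Type w} [AddCommGroup V] [Module K V] {W : Type w'}
    [AddCommGroup W] [Module K W] (ρ : Representation K H V) (σ : Representation K H W) :
    (Representation.ind H.subtype (ρ.prod σ)).Equiv
      ((Representation.ind H.subtype ρ).prod (Representation.ind H.subtype σ)) :=
  let p₁ : (ρ.prod σ).IntertwiningMap ρ := ⟨LinearMap.fst K V W, fun g => by ext <;> simp⟩
  let p₂ : (ρ.prod σ).IntertwiningMap σ := ⟨LinearMap.snd K V W, fun g => by ext <;> simp⟩
  let i₁ : ρ.IntertwiningMap (ρ.prod σ) := ⟨LinearMap.inl K V W, fun g => by ext <;> simp⟩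
  let i₂ : σ.IntertwiningMap (ρ.prod σ) := ⟨LinearMap.inr K V W, fun g => by ext <;> simp⟩
  .mk (LinearEquiv.ofLinearMap ((indMap H p₁).prod (indMap H p₂))
    ((indMap H i₁).coprod (indMap H i₂))
    (by
      refine LinearMap.prod_ext ?_ ?_ <;>
        refine Representation.IndV.hom_ext _ _ fun a => LinearMap.ext fun v => ?_
      · change (indMap H p₁ (indMap H i₁ (Representation.IndV.mk _ _ a v) + indMap H i₂ 0),
          indMap H p₂ (indMap H i₁ (Representation.IndV.mk _ _ a v) + indMap H i₂ 0)) =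
          (Representation.IndV.mk _ _ a v, 0)
        rw [map_zero, add_zero, indMap_mk, indMap_mk, indMap_mk]
        exact congrArg (Prod.mk _) (map_zero (Representation.IndV.mk H.subtype σ a))
      · change (indMap H p₁ (indMap H i₁ 0 + indMap H i₂ (Representation.IndV.mk _ _ a v)),
          indMap H p₂ (indMap H i₁ 0 + indMap H i₂ (Representation.IndV.mk _ _ a v))) =
          (0, Representation.IndV.mk _ _ a v)
        rw [map_zero, zero_add, indMap_mk, indMap_mk, indMap_mk]
        exact congrArg (Prod.mk · _) (map_zero (Representation.IndV.mk H.subtype ρ a)))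
    (Representation.IndV.hom_ext _ _ fun a => LinearMap.ext fun v => by
      change Representation.IndV.mk H.subtype (ρ.prod σ) a (v.1, 0) +
        Representation.IndV.mk H.subtype (ρ.prod σ) a (0, v.2) =
        Representation.IndV.mk H.subtype (ρ.prod σ) a v
      rw [← map_add, Prod.mk_add_mk, add_zero, zero_add])) fun g => by
    apply LinearMap.ext
    intro x
    exact Prod.ext (LinearMap.congr_fun (indMap_comp_ind H p₁ g) x)
      (LinearMap.congr_fun (indMap_comp_ind H p₂ g) x)

/-- Induction `R_K(H) → R_K(G)`, `[V] ↦ [K[G] ⊗_{K[H]} V]`. -/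
noncomputable def ind [Finite G] : CharRing K H →+ CharRing K G :=
  CharRing.lift (fun V => repClass (Representation.ind H.subtype (rep V)))
    (fun _ _ e => repClass_congr (indCongr H e))
    (fun V W => (repClass_congr (indProd H (rep V) (rep W))).trans (repClass_prod _ _))

variable (K G) in
/-- The `n`-th step `Fⁿ(G) = ∑_{H ≤ G} Ind_H^G(Γⁿ(H))` of the saturated filtration. -/
noncomputable def saturatedFiltration [Finite G] (n : ℕ) : AddSubgroup (CharRing K G) :=
  ⨆ H : Subgroup G, (gammaFiltration K H n).map (ind H)

theorem saturatedFiltration_antitone [Finite G] : Antitone (saturatedFiltration K G) :=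
  fun _ _ h => iSup_mono fun _ => AddSubgroup.map_mono (gammaFiltration_antitone h)

end induction

section topology

/-- The members of a decreasing sequence of subgroups, as a basis of neighbourhoods of zero. -/
@[reducible] def filtrationBasis {A : Type*} [AddCommGroup A] (F : ℕ → AddSubgroup A) (hF : Antitone F) :
    AddGroupFilterBasis A :=
  addGroupFilterBasisOfComm (Set.range fun n => (F n : Set A)) (Set.range_nonempty _)
    (by
      rintro _ _ ⟨m, rfl⟩ ⟨n, rfl⟩
      exact ⟨_, ⟨max m n, rfl⟩, Set.subset_inter (hF (le_max_left m n)) (hF (le_max_right m n))⟩)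
    (by
      rintro _ ⟨n, rfl⟩
      exact (F n).zero_mem)
    (by
      rintro _ ⟨n, rfl⟩
      refine ⟨_, ⟨n, rfl⟩, ?_⟩
      rintro _ ⟨x, hx, y, hy, rfl⟩
      exact (F n).add_mem hx hy)
    (by
      rintro _ ⟨n, rfl⟩
      exact ⟨_, ⟨n, rfl⟩, fun x hx => (F n).neg_mem hx⟩)

variable (K G) in
/-- The topology on `R_K(G)` defined by the Grothendieck filtration. -/
@[reducible] noncomputable def gammaTopology : TopologicalSpace (CharRing K G) :=
  (filtrationBasis (gammaFiltration K G) gammaFiltration_antitone).topology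

variable (K G) in
/-- The topology on `R_K(G)` defined by the saturated filtration. -/
@[reducible] noncomputable def saturatedTopology [Finite G] : TopologicalSpace (CharRing K G) :=
  (filtrationBasis (saturatedFiltration K G) saturatedFiltration_antitone).topology

/-- `R_K(G)` carries the topology of the Grothendieck filtration. -/
noncomputable instance : TopologicalSpace (CharRing K G) := gammaTopology K G

instance : IsTopologicalAddGroup (CharRing K G) :=
  (filtrationBasis (gammaFiltration K G) gammaFiltration_antitone).isTopologicalAddGroup

theorem hasBasis_nhds_zero :
    (nhds (0 : CharRing K G)).HasBasis (fun _ => True) fun n => (gammaFiltration K G n : Set _) := by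
  have h := (filtrationBasis (gammaFiltration K G) gammaFiltration_antitone).nhds_zero_hasBasis
  refine ⟨fun t => (h.mem_iff).trans ⟨?_, ?_⟩⟩
  · rintro ⟨_, ⟨n, rfl⟩, hn⟩
    exact ⟨n, trivial, hn⟩
  · rintro ⟨n, -, hn⟩
    exact ⟨_, ⟨n, rfl⟩, hn⟩

theorem mul_mem_gammaFiltration_right {n : ℕ} (x : CharRing K G) {y : CharRing K G}
    (hy : y ∈ gammaFiltration K G n) : x * y ∈ gammaFiltration K G n := by
  have hx : x ∈ gammaFiltration K G 0 := by rw [gammaFiltration_zero]; trivial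
  simpa using mul_mem_gammaFiltration hx hy

instance : IsTopologicalRing (CharRing K G) := by
  refine IsTopologicalRing.of_addGroup_of_nhds_zero ?_ (fun x => ?_) (fun x => ?_)
  · rw [(hasBasis_nhds_zero.prod_self).tendsto_iff hasBasis_nhds_zero]
    exact fun n _ => ⟨n, trivial, fun p hp => mul_mem_gammaFiltration_right _ hp.2⟩
  · rw [hasBasis_nhds_zero.tendsto_iff hasBasis_nhds_zero]
    exact fun n _ => ⟨n, trivial, fun p hp => mul_mem_gammaFiltration_right _ hp⟩
  · rw [hasBasis_nhds_zero.tendsto_iff hasBasis_nhds_zero]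
    exact fun n _ => ⟨n, trivial, fun p hp => by
      rw [SetLike.mem_coe, mul_comm]; exact mul_mem_gammaFiltration_right _ hp⟩

noncomputable instance : UniformSpace (CharRing K G) :=
  IsTopologicalAddGroup.rightUniformSpace (CharRing K G)

instance : IsUniformAddGroup (CharRing K G) := isUniformAddGroup_of_addCommGroup

variable (K G) in
/-- The completion of the topological ring `R_K(G)`. -/
abbrev CompletedCharRing : Type _ := UniformSpace.Completion (CharRing K G)


end topology

end

end VirtualChar

open VirtualChar

/-! Write `I_G` for the augmentation ideal of `R(G)`. Everything is reduced to adic topologies.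

The Grothendieck filtration defines the `I_G`-adic topology. Since `γ¹` is the identity, `I_G ^ n ≤
Γⁿ(G)` (`pow_augIdeal_le_gammaFiltration`). Conversely, in characteristic zero `K[G]` is semisimple,
so finitely many representations, of degree at most some `D`, generate `R(G)`
(`exists_finite_generators`). For `V` of degree `d ≤ D`, the series `γ_t([V] - d)` stops in degree
`d`. As `γ_t` is multiplicative, `γⁿ(x)` lies in `I_G ^ ⌈n/D⌉` for every `x` in `I_G`, and so `Γ^(D
n) ≤ I_G ^ n` (`gammaOp_mem_pow`, `gammaFiltration_le_pow`).

For `H ≤ G`, let `J` be the ideal of `R(H)` generated by the restriction of `I_G`. The projection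
formula `ind_res_mul` shows that induction maps `J ^ n` into `I_G ^ n`, so it is enough that a power
of `I_H` lies in `J`. As `I_H` is finitely generated, this can be checked modulo a prime `P`
containing `J`. There every class restricted from `G` becomes its degree, so `λ_t(Res Ind V)`
becomes a power of `1 + t`. Since `V` is a direct summand of `Res Ind V`, the polynomial `λ_t(V)`
divides it over the domain `R(H)/P`. Hence `λ_t(V)` is itself a power of `1 + t`, the exponent is
the degree of `V`, and the linear coefficient gives `[V] ≡ deg V`
(`repClass_sub_finrank_mem_radical`).

Thus each induction map is continuous. There are finitely many subgroups, so deep steps of `F` lie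
in deep steps of `Γ`; the term `H = G` gives the reverse comparison. -/

namespace VirtualChar


/-! ### Restriction of virtual characters and its compatibility with `λ` and `γ` -/

section restriction

variable {K : Type u} [Field K] {G : Type v} [Group G] {G' : Type v} [Group G'] (f : G' →* G)

/-- The restriction of a representation along a group homomorphism. -/
abbrev resRep {V : Type w} [AddCommGroup V] [Module K V] (ρ : Representation K G V) :
    Representation K G' V := MonoidHom.comp ρ f

/-- Isomorphic representations have isomorphic restrictions. -/
def resCongr {V : Type w} [AddCommGroup V] [Module K V] {W : Type w'} [AddCommGroup W] [Module K W]
    {ρ : Representation K G V} {σ : Representation K G W} (e : ρ.Equiv σ) :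
    (resRep f ρ).Equiv (resRep f σ) :=
  .mk e.toLinearEquiv fun g => e.toIntertwiningMap.isIntertwining' (f g)

/-- Restriction of virtual characters, as an additive map. -/
noncomputable def resAddHom : CharRing K G →+ CharRing K G' :=
  CharRing.lift (fun V => repClass (resRep f (rep V)))
    (fun _ _ e => repClass_congr (resCongr f e))
    (fun V W => repClass_prod (resRep f (rep V)) (resRep f (rep W)))

/-- `CharRing.lift_rep` speaks of objects of `FDRep K G` only; passing to coordinates covers spaces
in every universe, such as exterior powers and induced modules. -/
theorem resAddHom_repClass {V : Type w} [AddCommGroup V] [Module K V] [Module.Finite K V]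
    (ρ : Representation K G V) : resAddHom f (repClass ρ) = repClass (resRep f ρ) := by
  rw [repClass_congr (coordEquiv ρ), repClass_congr (resCongr f (coordEquiv ρ))]
  exact CharRing.lift_rep _ _ _ (FDRep.of (coordRep ρ))

/-- The restriction homomorphism `R_K(G) → R_K(G')`. -/
noncomputable def res : CharRing K G →+* CharRing K G' :=
  { resAddHom f with
    map_one' := by
      change resAddHom f 1 = 1
      rw [← repClass_trivial, resAddHom_repClass, ← repClass_trivial]
      rfl
    map_mul' := fun x y => by
      change resAddHom f (x * y) = resAddHom f x * resAddHom f y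
      induction x using CharRing.induction with
      | hneg x hx => rw [neg_mul, map_neg, hx, map_neg, neg_mul]
      | hadd x z hx hz => rw [add_mul, map_add, hx, hz, map_add, add_mul]
      | hrep V =>
        induction y using CharRing.induction with
        | hneg x hx => rw [mul_neg, map_neg, hx, map_neg, mul_neg]
        | hadd x z hx hz => rw [mul_add, map_add, hx, hz, map_add, mul_add]
        | hrep W =>
          rw [← repClass_tprod, resAddHom_repClass, resAddHom_repClass, resAddHom_repClass,
            ← repClass_tprod]
          rfl }

theorem res_repClass {V : Type w} [AddCommGroup V] [Module K V] [Module.Finite K V]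
    (ρ : Representation K G V) : res f (repClass ρ) = repClass (resRep f ρ) :=
  resAddHom_repClass f ρ

theorem augmentation_rep (V : FDRep K G) :
    augmentation K G (repClass (rep V)) = Module.finrank K V :=
  CharRing.lift_rep (fun V => (Module.finrank K V : ℤ))
    (fun _ _ e => by rw [e.toLinearEquiv.finrank_eq])
    (fun V W => by
      change ((Module.finrank K (V × W) : ℕ) : ℤ) = _
      rw [Module.finrank_prod, Nat.cast_add]) V

theorem augmentation_repClass {V : Type w} [AddCommGroup V] [Module K V] [Module.Finite K V]
    (ρ : Representation K G V) : augmentation K G (repClass ρ) = Module.finrank K V := by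
  rw [repClass_congr (coordEquiv ρ)]
  refine (augmentation_rep (FDRep.of (coordRep ρ))).trans ?_
  change ((Module.finrank K (Fin (Module.finrank K V) → K) : ℕ) : ℤ) = _
  rw [Module.finrank_fin_fun]

theorem augmentation_res (x : CharRing K G) :
    augmentation K G' (res f x) = augmentation K G x := by
  induction x using CharRing.induction with
  | hneg x hx => rw [map_neg, map_neg, hx, map_neg]
  | hadd x y hx hy => rw [map_add, map_add, hx, hy, map_add]
  | hrep V => rw [res_repClass, augmentation_repClass, augmentation_repClass]

theorem lambdaOp_repClass (n : ℕ) {V : Type w} [AddCommGroup V] [Module K V] [Module.Finite K V]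
    (ρ : Representation K G V) : lambdaOp n (repClass ρ) = repClass (extRep n ρ) := by
  rw [repClass_congr (coordEquiv ρ), repClass_congr (extCongr n (coordEquiv ρ))]
  exact lambdaOp_rep n (FDRep.of (coordRep ρ))

/-- The power series `λ_t(x) = ∑ₙ λⁿ(x) tⁿ` of a virtual character. -/
noncomputable def lambdaPS (x : CharRing K G) : PowerSeries (CharRing K G) :=
  ((lambdaHom x).toMul : PowerSeries (CharRing K G))

theorem coeff_lambdaPS (n : ℕ) (x : CharRing K G) :
    PowerSeries.coeff n (lambdaPS x) = lambdaOp n x := rfl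

theorem lambdaPS_add (x y : CharRing K G) : lambdaPS (x + y) = lambdaPS x * lambdaPS y := by
  rw [lambdaPS, map_add, toMul_add, Units.val_mul]
  rfl

theorem lambdaPS_zero : lambdaPS (0 : CharRing K G) = 1 := by
  rw [lambdaPS, map_zero, toMul_zero, Units.val_one]

theorem lambdaPS_mul_neg (x : CharRing K G) : lambdaPS x * lambdaPS (-x) = 1 := by
  rw [← lambdaPS_add, add_neg_cancel, lambdaPS_zero]

theorem map_lambdaPS_neg {S : Type*} [CommRing S] (φ : CharRing K G →+* S) (x : CharRing K G) :
    PowerSeries.map φ (lambdaPS x) * PowerSeries.map φ (lambdaPS (-x)) = 1 := by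
  rw [← map_mul, lambdaPS_mul_neg, map_one]

/-- On representations, exterior powers commute with restriction by definition. Multiplicativity of
`λ_t` handles sums, and uniqueness of inverses handles negatives. -/
theorem map_res_lambdaPS (x : CharRing K G) :
    PowerSeries.map (res f) (lambdaPS x) = lambdaPS (res f x) := by
  induction x using CharRing.induction with
  | hadd x y hx hy => rw [lambdaPS_add, map_mul, hx, hy, map_add, lambdaPS_add]
  | hneg x hx =>
    have h := map_lambdaPS_neg (res f) x
    rw [hx] at h
    rw [map_neg]
    exact (left_inv_eq_right_inv (by rw [mul_comm]; exact lambdaPS_mul_neg (res f x)) h).symm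
  | hrep V =>
    ext n
    rw [PowerSeries.coeff_map, coeff_lambdaPS, coeff_lambdaPS, lambdaOp_repClass, res_repClass,
      res_repClass, lambdaOp_repClass]
    rfl

theorem res_lambdaOp (n : ℕ) (x : CharRing K G) :
    res f (lambdaOp n x) = lambdaOp n (res f x) := by
  rw [← coeff_lambdaPS, ← coeff_lambdaPS, ← map_res_lambdaPS, PowerSeries.coeff_map]

theorem res_gammaOp (n : ℕ) (x : CharRing K G) :
    res f (gammaOp n x) = gammaOp n (res f x) := by
  rw [gammaOp, res_lambdaOp, gammaOp, map_sub, map_add, map_natCast, map_one]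

theorem res_mem_gammaFiltration {n : ℕ} {x : CharRing K G} (hx : x ∈ gammaFiltration K G n) :
    res f x ∈ gammaFiltration K G' n := by
  induction hx using AddSubgroup.closure_induction with
  | zero => rw [map_zero]; exact zero_mem _
  | add x y _ _ hx hy => rw [map_add]; exact add_mem hx hy
  | neg x _ hx => rw [map_neg]; exact neg_mem hx
  | mem x hx =>
    obtain ⟨l, h1, h2, rfl⟩ := hx
    refine AddSubgroup.subset_closure ⟨l.map fun p => (p.1, res f p.2), ?_, ?_, ?_⟩
    · intro p hp
      obtain ⟨q, hq, rfl⟩ := List.mem_map.1 hp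
      exact (augmentation_res f q.2).trans (h1 q hq)
    · simpa [Function.comp_def] using h2
    · rw [map_list_prod, List.map_map, List.map_map]
      exact congrArg List.prod (List.map_congr_left fun p _ => res_gammaOp f _ _)

end restriction

/-! ### Values of `λ_t` on representations and on integers -/

section lambdaValues

variable {K : Type u} [Field K] {G : Type v} [Group G]

/-- The zero representation is its own double, so its class `c` satisfies `c = c + c`. -/
theorem repClass_eq_zero {V : Type w} [AddCommGroup V] [Module K V] [Module.Finite K V]
    (ρ : Representation K G V) (h : Module.finrank K V = 0) : repClass ρ = 0 := by
  have := Module.finrank_zero_iff.1 h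
  have e : ρ.Equiv (ρ.prod ρ) := .mk 0 fun g => LinearMap.ext fun x => Subsingleton.elim _ _
  have h := repClass_prod ρ ρ
  rw [← repClass_congr e] at h
  simpa using h

theorem lambdaOp_repClass_eq_zero {V : Type w} [AddCommGroup V] [Module K V] [Module.Finite K V]
    (ρ : Representation K G V) {n : ℕ} (h : Module.finrank K V < n) :
    lambdaOp n (repClass ρ) = 0 := by
  rw [lambdaOp_repClass]
  exact repClass_eq_zero _ (by rw [exteriorPower.finrank_eq, Nat.choose_eq_zero_of_lt h])

theorem lambdaPS_one : lambdaPS (1 : CharRing K G) = 1 + PowerSeries.X := by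
  ext n
  rw [coeff_lambdaPS, map_add, PowerSeries.coeff_one, PowerSeries.coeff_X]
  match n with
  | 0 => simp [lambdaOp_zero]
  | 1 => simp [lambdaOp_one]
  | n + 2 =>
    rw [← repClass_trivial, lambdaOp_repClass_eq_zero _ (by rw [Module.finrank_self]; omega)]
    simp

theorem lambdaPS_natCast (m : ℕ) : lambdaPS (m : CharRing K G) = (1 + PowerSeries.X) ^ m := by
  induction m with
  | zero => rw [Nat.cast_zero, lambdaPS_zero, pow_zero]
  | succ m ih => rw [Nat.cast_succ, lambdaPS_add, ih, lambdaPS_one, pow_succ]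

theorem coeff_one_add_X_pow' {R : Type*} [CommRing R] (m n : ℕ) :
    PowerSeries.coeff n ((1 + PowerSeries.X : PowerSeries R) ^ m) = (m.choose n : R) := by
  have : (1 + PowerSeries.X : PowerSeries R) ^ m = ((1 + Polynomial.X : Polynomial R) ^ m : _) := by
    simp
  rw [this, Polynomial.coeff_coe, Polynomial.coeff_one_add_X_pow]

theorem map_augmentation_lambdaPS_repClass {V : Type w} [AddCommGroup V] [Module K V]
    [Module.Finite K V] (ρ : Representation K G V) :
    PowerSeries.map (augmentation K G) (lambdaPS (repClass ρ)) =
      (1 + PowerSeries.X) ^ Module.finrank K V := by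
  ext n
  rw [PowerSeries.coeff_map, coeff_lambdaPS, lambdaOp_repClass, augmentation_repClass,
    exteriorPower.finrank_eq, coeff_one_add_X_pow']

end lambdaValues

/-! ### Power series with coefficients in growing powers of an ideal -/

section filteredSeries

variable {R : Type*} [CommRing R]

/-- The power series whose `n`-th coefficient lies in `I ^ ⌈n / D⌉`. -/
def IsFilteredSeries (I : Ideal R) (D : ℕ) (f : PowerSeries R) : Prop :=
  ∀ n, PowerSeries.coeff n f ∈ I ^ (n ⌈/⌉ D)

/-- This is the inequality `⌈(a + b)/D⌉ ≤ ⌈a/D⌉ + ⌈b/D⌉`. -/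
theorem mul_mem_pow_ceilDiv {I : Ideal R} {D a b : ℕ} (hD : 0 < D) {x y : R}
    (hx : x ∈ I ^ (a ⌈/⌉ D)) (hy : y ∈ I ^ (b ⌈/⌉ D)) : x * y ∈ I ^ ((a + b) ⌈/⌉ D) := by
  have h := Ideal.mul_mem_mul hx hy
  rw [← pow_add] at h
  refine Ideal.pow_le_pow_right ?_ h
  rw [ceilDiv_le_iff_le_mul hD, mul_add]
  exact add_le_add ((ceilDiv_le_iff_le_mul hD).1 le_rfl) ((ceilDiv_le_iff_le_mul hD).1 le_rfl)

theorem IsFilteredSeries.mul {I : Ideal R} {D : ℕ} (hD : 0 < D) {f g : PowerSeries R}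
    (hf : IsFilteredSeries I D f) (hg : IsFilteredSeries I D g) : IsFilteredSeries I D (f * g) := by
  intro n
  rw [PowerSeries.coeff_mul]
  refine sum_mem fun p hp => ?_
  rw [← Finset.HasAntidiagonal.mem_antidiagonal.1 hp]
  exact mul_mem_pow_ceilDiv hD (hf _) (hg _)

theorem IsFilteredSeries.inv {I : Ideal R} {D : ℕ} (hD : 0 < D) {f g : PowerSeries R}
    (hf : IsFilteredSeries I D f) (h0 : PowerSeries.coeff 0 f = 1) (hfg : f * g = 1) :
    IsFilteredSeries I D g := by
  intro n
  induction n using Nat.strong_induction_on with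
  | _ n ih =>
    rcases Nat.eq_zero_or_pos n with rfl | hn
    · rw [zero_ceilDiv, pow_zero, Ideal.one_eq_top]
      trivial
    have h := congrArg (PowerSeries.coeff n) hfg
    rw [PowerSeries.coeff_mul, PowerSeries.coeff_one, if_neg hn.ne',
      -- Isolating the term `f₀ gₙ = gₙ` expresses `gₙ` through the earlier coefficients of `g`.
      ← Finset.add_sum_erase _ _ (a := (0, n))
        (Finset.HasAntidiagonal.mem_antidiagonal.2 (zero_add n)), h0, one_mul] at h
    rw [eq_neg_of_add_eq_zero_left h]
    refine neg_mem (sum_mem fun p hp => ?_)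
    obtain ⟨h1, h2⟩ := Finset.mem_erase.1 hp
    rw [Finset.HasAntidiagonal.mem_antidiagonal] at h2
    rw [← h2]
    refine mul_mem_pow_ceilDiv hD (hf _) (ih _ ?_)
    have : p.1 ≠ 0 := fun h => h1 (Prod.ext h (by simpa [h] using h2))
    omega

/-- `mk 1` is `1/(1 - t)`, so this expands `(t/(1 - t)) ^ d`. The binomial is written as the
coefficient of `(1 + t) ^ n` in degree `n + 1 - d`, to match `gammaOp_succ`; for `d = 0` it
vanishes. -/
theorem coeff_X_mul_mk_one_pow (d n : ℕ) :
    PowerSeries.coeff (n + 1) ((PowerSeries.X * PowerSeries.mk 1 : PowerSeries R) ^ d) =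
      if d ≤ n + 1 then (n.choose (n + 1 - d) : R) else 0 := by
  rw [mul_pow, PowerSeries.coeff_X_pow_mul']
  split_ifs with h
  · rcases d with _ | d
    · rw [pow_zero, PowerSeries.coeff_one, if_neg (by omega), Nat.choose_eq_zero_of_lt (by omega),
        Nat.cast_zero]
    · rw [PowerSeries.mk_one_pow_eq_mk_choose_add, PowerSeries.coeff_mk]
      have h' : d ≤ n := by omega
      rw [show n + 1 - (d + 1) = n - d by omega, Nat.add_sub_cancel' h', Nat.choose_symm h']
  · rfl

theorem hasSubst_X_mul_mk_one :
    PowerSeries.HasSubst (PowerSeries.X * PowerSeries.mk 1 : PowerSeries R) :=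
  PowerSeries.HasSubst.of_constantCoeff_zero' (by simp)

end filteredSeries

/-! ### The series `γ_t` and the comparison of `Γⁿ` with powers of the augmentation ideal -/

section gamma

variable {K : Type u} [Field K] {G : Type v} [Group G]

/-- The power series `γ_t(x) = λ_{t/(1-t)}(x)` of a virtual character. -/
noncomputable def gammaPS (x : CharRing K G) : PowerSeries (CharRing K G) :=
  (lambdaPS x).subst (PowerSeries.X * PowerSeries.mk 1 : PowerSeries (CharRing K G))

theorem gammaPS_add (x y : CharRing K G) : gammaPS (x + y) = gammaPS x * gammaPS y := by
  rw [gammaPS, lambdaPS_add, PowerSeries.subst_mul hasSubst_X_mul_mk_one]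
  rfl

theorem gammaPS_zero : gammaPS (0 : CharRing K G) = 1 := by
  rw [gammaPS, lambdaPS_zero, ← PowerSeries.coe_substAlgHom hasSubst_X_mul_mk_one, map_one]

theorem coeff_zero_gammaPS (x : CharRing K G) : PowerSeries.coeff 0 (gammaPS x) = 1 := by
  rw [gammaPS, PowerSeries.coeff_subst' hasSubst_X_mul_mk_one, finsum_eq_single _ 0]
  · simp [coeff_lambdaPS, lambdaOp_zero]
  · intro d hd
    simp [hd]

/-- The shift `(n + 1) - 1` is the natural number `n`, and `λ_t(n) = (1 + t) ^ n`. For `γ⁰` the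
shift would be `-1`, hence the successor. -/
theorem gammaOp_succ (n : ℕ) (x : CharRing K G) : gammaOp (n + 1) x =
    PowerSeries.coeff (n + 1) (lambdaPS x * (1 + PowerSeries.X) ^ n) := by
  rw [gammaOp, ← lambdaPS_natCast, ← lambdaPS_add, coeff_lambdaPS, Nat.cast_succ, ← add_assoc,
    add_sub_cancel_right]

/-- In degree `n + 1` both sides are `∑ λᵈ(x) * (n.choose (n + 1 - d))`. Through this identity,
`gammaPS_add` controls `γⁿ` of sums and negatives. -/
theorem coeff_gammaPS (n : ℕ) (x : CharRing K G) :
    PowerSeries.coeff n (gammaPS x) = gammaOp n x := by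
  rcases n with _ | n
  · rw [coeff_zero_gammaPS, gammaOp, lambdaOp_zero]
  rw [gammaOp_succ, gammaPS, PowerSeries.coeff_subst' hasSubst_X_mul_mk_one,
    PowerSeries.coeff_mul, Finset.Nat.sum_antidiagonal_eq_sum_range_succ_mk,
    finsum_eq_sum_of_support_subset (s := Finset.range (n + 1).succ)]
  · refine Finset.sum_congr rfl fun d hd => ?_
    rw [coeff_X_mul_mk_one_pow, if_pos (Nat.lt_succ_iff.1 (Finset.mem_range.1 hd)),
      coeff_one_add_X_pow', smul_eq_mul]
  · intro d hd
    rw [Finset.coe_range, Set.mem_Iio, Nat.lt_succ_iff]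
    by_contra h
    exact hd (by simp only [coeff_X_mul_mk_one_pow, if_neg h, smul_zero])

variable (K G) in
/-- The augmentation ideal. -/
noncomputable abbrev augIdeal : Ideal (CharRing K G) := RingHom.ker (augmentation K G)

/-- With `d` the degree and `n = d + m + 1`, the argument of `λⁿ` becomes `[V] + m`, an effective
class of degree `d + m < n`. -/
theorem gammaOp_repClass_sub_eq_zero {V : Type w} [AddCommGroup V] [Module K V]
    [Module.Finite K V] (ρ : Representation K G V) {n : ℕ} (h : Module.finrank K V < n) :
    gammaOp n (repClass ρ - (Module.finrank K V : CharRing K G)) = 0 := by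
  obtain ⟨m, rfl⟩ := Nat.exists_eq_add_of_lt h
  rw [gammaOp]
  have : repClass ρ - (Module.finrank K V : CharRing K G) + (Module.finrank K V + m + 1 : ℕ) - 1 =
      repClass ρ + (m : CharRing K G) := by push_cast; ring
  rw [this, lambdaOp_add]
  refine Finset.sum_eq_zero fun p hp => ?_
  rw [Finset.HasAntidiagonal.mem_antidiagonal] at hp
  by_cases h1 : Module.finrank K V < p.1
  · rw [lambdaOp_repClass_eq_zero ρ h1, zero_mul]
  · rw [← coeff_lambdaPS p.2, lambdaPS_natCast, coeff_one_add_X_pow',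
      Nat.choose_eq_zero_of_lt (by omega), Nat.cast_zero, mul_zero]

theorem isUnit_one_add_X_pow {R : Type*} [CommRing R] (d : ℕ) :
    IsUnit ((1 + PowerSeries.X : PowerSeries R) ^ d) :=
  IsUnit.pow d (by rw [PowerSeries.isUnit_iff_constantCoeff]; simp)

/-- The augmentation turns `λ_t([V] - d)` into `(1 + t) ^ d / (1 + t) ^ d = 1`, so what remains of
`γ^(n+1)` is the coefficient of `t ^ (n + 1)` in `(1 + t) ^ n`. -/
theorem gammaOp_repClass_sub_mem {V : Type w} [AddCommGroup V] [Module K V]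
    [Module.Finite K V] (ρ : Representation K G V) (n : ℕ) :
    gammaOp (n + 1) (repClass ρ - (Module.finrank K V : CharRing K G)) ∈ augIdeal K G := by
  set d := Module.finrank K V with hd
  have h : PowerSeries.map (augmentation K G) (lambdaPS (repClass ρ - (d : CharRing K G))) = 1 := by
    have h1 : lambdaPS (repClass ρ - (d : CharRing K G)) * lambdaPS (d : CharRing K G) =
        lambdaPS (repClass ρ) := by rw [← lambdaPS_add, sub_add_cancel]
    have h2 := congrArg (PowerSeries.map (augmentation K G)) h1
    rw [map_mul, map_augmentation_lambdaPS_repClass, lambdaPS_natCast, map_pow, map_add, map_one,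
      PowerSeries.map_X, ← hd] at h2
    exact (isUnit_one_add_X_pow d).mul_right_cancel (h2.trans (one_mul _).symm)
  rw [RingHom.mem_ker, gammaOp_succ, ← PowerSeries.coeff_map, map_mul, h, one_mul, map_pow,
    map_add, map_one, PowerSeries.map_X, coeff_one_add_X_pow', Nat.choose_succ_self, Nat.cast_zero]

/-- In degrees from `1` to `D` only membership in the first power is required; beyond `D` the
coefficients vanish. -/
theorem isFilteredSeries_gammaPS_repClass {V : Type w} [AddCommGroup V] [Module K V]
    [Module.Finite K V] (ρ : Representation K G V) {D : ℕ} (h : Module.finrank K V ≤ D) :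
    IsFilteredSeries (augIdeal K G) D
      (gammaPS (repClass ρ - (Module.finrank K V : CharRing K G))) := by
  intro n
  rw [coeff_gammaPS]
  rcases n with _ | n
  · rw [zero_ceilDiv, pow_zero, Ideal.one_eq_top]
    trivial
  by_cases hn : n + 1 ≤ D
  · refine Ideal.pow_le_pow_right (n := 1) ?_ (by
      rw [pow_one]; exact gammaOp_repClass_sub_mem ρ n)
    rw [ceilDiv_le_iff_le_mul (by omega)]
    omega
  · rw [gammaOp_repClass_sub_eq_zero ρ (by omega)]
    exact zero_mem _

/-- If the classes of representations of degree at most `D` generate `R_K(G)`, then `γⁿ(x)` lies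
in the power `⌈n / D⌉` of the augmentation ideal, for all `x` of augmentation zero. -/
theorem gammaOp_mem_pow {D : ℕ} (hD : 0 < D) (hgen : AddSubgroup.closure
    {x | ∃ V : FDRep K G, Module.finrank K V ≤ D ∧ x = repClass (rep V)} = ⊤)
    {x : CharRing K G} (hx : augmentation K G x = 0) (n : ℕ) :
    gammaOp n x ∈ augIdeal K G ^ (n ⌈/⌉ D) := by
  -- The generators do not have augmentation zero, so the induction runs over `x - ε(x)` for
  -- arbitrary `x`.
  have key : IsFilteredSeries (augIdeal K G) D
      (gammaPS (x - (augmentation K G x : CharRing K G))) := by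
    have hx' : x ∈ AddSubgroup.closure
        {x | ∃ V : FDRep K G, Module.finrank K V ≤ D ∧ x = repClass (rep V)} := hgen ▸ AddSubgroup.mem_top x
    clear hx
    induction hx' using AddSubgroup.closure_induction with
    | mem x hx =>
      obtain ⟨V, hV, rfl⟩ := hx
      rw [augmentation_repClass, Int.cast_natCast]
      exact isFilteredSeries_gammaPS_repClass (rep V) hV
    | zero =>
      rw [map_zero, Int.cast_zero, sub_zero, gammaPS_zero]
      intro n
      rw [PowerSeries.coeff_one]
      split_ifs with h
      · rw [h, zero_ceilDiv, pow_zero, Ideal.one_eq_top]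
        trivial
      · exact zero_mem _
    | add x y _ _ hx hy =>
      rw [map_add, Int.cast_add, add_sub_add_comm, gammaPS_add]
      exact hx.mul hD hy
    | neg x _ hx =>
      refine hx.inv hD (coeff_zero_gammaPS _) ?_
      rw [← gammaPS_add, map_neg, Int.cast_neg, ← gammaPS_zero]
      congr 1
      ring
  have := key n
  rwa [coeff_gammaPS, hx, Int.cast_zero, sub_zero] at this

theorem gammaFiltration_le_pow {D : ℕ} (hD : 0 < D) (hgen : AddSubgroup.closure
    {x | ∃ V : FDRep K G, Module.finrank K V ≤ D ∧ x = repClass (rep V)} = ⊤) (n : ℕ) :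
    gammaFiltration K G (D * n) ≤ (augIdeal K G ^ n).toAddSubgroup := by
  refine (AddSubgroup.closure_le _).2 ?_
  rintro _ ⟨l, h1, h2, rfl⟩
  have key : (l.map fun p => gammaOp p.1 p.2).prod ∈
      augIdeal K G ^ ((l.map fun p => p.1).sum ⌈/⌉ D) := by
    clear h2
    induction l with
    | nil => simp
    | cons p l ih =>
      rw [List.map_cons, List.map_cons, List.prod_cons, List.sum_cons]
      exact mul_mem_pow_ceilDiv hD (gammaOp_mem_pow hD hgen (h1 p (by simp)) _)
        (ih fun q hq => h1 q (by simp [hq]))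
  refine Ideal.pow_le_pow_right ?_ key
  -- If `⌈s/D⌉ ≤ n - 1` for the total weight `s`, then `s ≤ D (n - 1) < D n`, against the bound on
  -- the weight.
  by_contra hlt
  have h3 := (ceilDiv_le_iff_le_mul hD).1 (Nat.le_sub_one_of_lt (not_le.1 hlt))
  have : D * (n - 1) < D * n := Nat.mul_lt_mul_of_pos_left (by omega) hD
  omega

/-- Since `γ¹` is the identity, a product of `n` elements of augmentation zero is a monomial of
weight `n`. -/
theorem pow_augIdeal_le_gammaFiltration (n : ℕ) :
    (augIdeal K G ^ n).toAddSubgroup ≤ gammaFiltration K G n := by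
  induction n with
  | zero => rw [gammaFiltration_zero]; exact le_top
  | succ n ih =>
    intro x hx
    change x ∈ augIdeal K G ^ (n + 1) at hx
    rw [pow_succ] at hx
    refine Submodule.mul_induction_on hx (fun a ha b hb => ?_) fun a b ha hb => add_mem ha hb
    refine mul_mem_gammaFiltration (ih ha) (AddSubgroup.subset_closure ⟨[(1, b)], ?_, ?_, ?_⟩)
    · simpa using hb
    · simp
    · simp [gammaOp_one]

end gamma

/-! ### Induced representations: projection formula, induction from `G` itself, splitting of `Res
Ind` -/

section induced

variable {K : Type u} [Field K] {G : Type v} [Group G] (H : Subgroup G)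
  {V : Type w} [AddCommGroup V] [Module K V]

/-- This is the coinvariance relation defining the induced space. Here `H` multiplies `G` on the
left, while `G` acts through right multiplication by inverses. -/
theorem indV_mk_mul (ρ : Representation K H V) (h : H) (g : G) (v : V) :
    Representation.IndV.mk H.subtype ρ (h * g) (ρ h v) = Representation.IndV.mk H.subtype ρ g v := by
  have := Representation.Coinvariants.mk_self_apply
    (Representation.tprod ((Representation.leftRegular K G).comp H.subtype) ρ) h
    (TensorProduct.tmul K (MonoidAlgebra.single g 1) v)
  simpa using this

/-- The linear map out of an induced representation given by a compatible family of maps. -/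
noncomputable def indLift (ρ : Representation K H V) {B : Type*} [AddCommGroup B] [Module K B]
    (f : G → V →ₗ[K] B) (hf : ∀ (h : H) (g : G) (v : V), f (h * g) (ρ h v) = f g v) :
    Representation.IndV H.subtype ρ →ₗ[K] B :=
  Representation.Coinvariants.lift _
    (TensorProduct.lift <| (Finsupp.lift _ _ _ f) ∘ₗ
      (MonoidAlgebra.coeffLinearEquiv K).toLinearMap)
    fun h => by
      ext g v
      simp [hf]

theorem indLift_mk (ρ : Representation K H V) {B : Type*} [AddCommGroup B] [Module K B]
    (f : G → V →ₗ[K] B) (hf : ∀ (h : H) (g : G) (v : V), f (h * g) (ρ h v) = f g v) (g : G) (v : V) :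
    indLift H ρ f hf (Representation.IndV.mk H.subtype ρ g v) = f g v := by
  simp [indLift]

section tensor
variable {W : Type w'} [AddCommGroup W] [Module K W] (τ : Representation K G W)
  (ρ : Representation K H V)

/-- The map `Ind (Res W ⊗ V) → W ⊗ Ind V`. -/
noncomputable def indTensorMap :
    Representation.IndV H.subtype ((resRep H.subtype τ).tprod ρ) →ₗ[K]
      TensorProduct K W (Representation.IndV H.subtype ρ) :=
  -- The symbol at `g` behaves as a translate by `g⁻¹`, hence the twist of `W` by `τ g⁻¹`.
  indLift H _ (fun g => TensorProduct.map (τ g⁻¹) (Representation.IndV.mk H.subtype ρ g))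
    fun h g x => by
      induction x with
      | zero => simp
      | add x y hx hy => rw [map_add, map_add, hx, hy, map_add]
      | tmul w v =>
        rw [Representation.tprod_apply, TensorProduct.map_tmul, TensorProduct.map_tmul,
          TensorProduct.map_tmul, indV_mk_mul]
        simp [← Module.End.mul_apply, ← map_mul]

theorem indTensorMap_mk (g : G) (w : W) (v : V) :
    indTensorMap H τ ρ (Representation.IndV.mk H.subtype _ g (TensorProduct.tmul K w v)) =
      TensorProduct.tmul K (τ g⁻¹ w) (Representation.IndV.mk H.subtype ρ g v) := by
  rw [indTensorMap, indLift_mk, TensorProduct.map_tmul]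

/-- The map `W ⊗ Ind V → Ind (Res W ⊗ V)`. -/
noncomputable def indTensorInv : TensorProduct K W (Representation.IndV H.subtype ρ) →ₗ[K]
    Representation.IndV H.subtype ((resRep H.subtype τ).tprod ρ) :=
  TensorProduct.lift (LinearMap.flip (indLift H ρ
    (fun g => LinearMap.flip ((TensorProduct.mk K W V).compr₂
      (Representation.IndV.mk H.subtype ((resRep H.subtype τ).tprod ρ) g) ∘ₗ τ g))
    (fun h g v => by
      ext w
      have := indV_mk_mul H ((resRep H.subtype τ).tprod ρ) h g (TensorProduct.tmul K (τ g w) v)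
      rw [Representation.tprod_apply, TensorProduct.map_tmul] at this
      simpa [map_mul] using this)))

theorem indTensorInv_mk (g : G) (w : W) (v : V) :
    indTensorInv H τ ρ (TensorProduct.tmul K w (Representation.IndV.mk H.subtype ρ g v)) =
      Representation.IndV.mk H.subtype _ g (TensorProduct.tmul K (τ g w) v) := by
  rw [indTensorInv, TensorProduct.lift.tmul, LinearMap.flip_apply, indLift_mk]
  rfl

/-- The projection formula `Ind (Res W ⊗ V) ≃ W ⊗ Ind V`. -/
noncomputable def indTensorEquiv :
    (Representation.ind H.subtype ((resRep H.subtype τ).tprod ρ)).Equiv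
      (τ.tprod (Representation.ind H.subtype ρ)) :=
  .mk (LinearEquiv.ofLinearMap (indTensorMap H τ ρ) (indTensorInv H τ ρ)
    (by
      refine TensorProduct.ext (LinearMap.ext fun w => ?_)
      refine Representation.IndV.hom_ext _ _ fun g => LinearMap.ext fun v => ?_
      change indTensorMap H τ ρ (indTensorInv H τ ρ (TensorProduct.tmul K w
        (Representation.IndV.mk H.subtype ρ g v))) = _
      rw [indTensorInv_mk, indTensorMap_mk, ← Module.End.mul_apply, ← map_mul, inv_mul_cancel,
        map_one, Module.End.one_apply]
      rfl)
    (by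
      refine Representation.IndV.hom_ext _ _ fun g => TensorProduct.ext' fun w v => ?_
      change indTensorInv H τ ρ (indTensorMap H τ ρ (Representation.IndV.mk H.subtype _ g
        (TensorProduct.tmul K w v))) = _
      rw [indTensorMap_mk, indTensorInv_mk, ← Module.End.mul_apply, ← map_mul, mul_inv_cancel,
        map_one, Module.End.one_apply]
      rfl))
    fun x => by
      refine Representation.IndV.hom_ext _ _ fun g => TensorProduct.ext' fun w v => ?_
      change indTensorMap H τ ρ (Representation.ind H.subtype _ x
        (Representation.IndV.mk H.subtype _ g (TensorProduct.tmul K w v))) =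
          τ.tprod (Representation.ind H.subtype ρ) x (indTensorMap H τ ρ
            (Representation.IndV.mk H.subtype _ g (TensorProduct.tmul K w v)))
      rw [Representation.ind_mk, indTensorMap_mk, indTensorMap_mk, Representation.tprod_apply,
        TensorProduct.map_tmul, Representation.ind_mk, mul_inv_rev, inv_inv, map_mul,
        Module.End.mul_apply]

end tensor

theorem ind_repClass [Finite G] [Module.Finite K V] (ρ : Representation K H V) :
    ind H (repClass ρ) = repClass (Representation.ind H.subtype ρ) := by
  rw [repClass_congr (coordEquiv ρ), repClass_congr (indCongr H (coordEquiv ρ))]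
  exact CharRing.lift_rep _ _ _ (FDRep.of (coordRep ρ))

/-- Both sides are additive in each variable, which reduces the formula to `indTensorEquiv`. It says
that induction is `R(G)`-linear. -/
theorem ind_res_mul [Finite G] (x : CharRing K G) (y : CharRing K H) :
    ind H (res H.subtype x * y) = x * ind H y := by
  induction x using CharRing.induction with
  | hneg x hx => rw [map_neg, neg_mul, map_neg, hx, neg_mul]
  | hadd x z hx hz => rw [map_add, add_mul, map_add, hx, hz, add_mul]
  | hrep W =>
    induction y using CharRing.induction with
    | hneg y hy => rw [map_neg, mul_neg, map_neg, hy, mul_neg]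
    | hadd y z hy hz => rw [map_add, mul_add, map_add, hy, hz, mul_add]
    | hrep V =>
      rw [res_repClass, ← repClass_tprod, ind_repClass, ind_repClass, ← repClass_tprod]
      exact repClass_congr (indTensorEquiv H (rep W) (rep V))

/-- The map from the trivial representation, induced from the whole group, to the trivial
representation. -/
noncomputable def indTopTrivialMap : Representation.IndV (⊤ : Subgroup G).subtype
    (Representation.trivial K (⊤ : Subgroup G) K) →ₗ[K] K :=
  indLift ⊤ _ (fun _ => LinearMap.id) fun _ _ _ => by simp

theorem indTopTrivialMap_mk (g : G) (v : K) :
    indTopTrivialMap (Representation.IndV.mk (⊤ : Subgroup G).subtype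
      (Representation.trivial K (⊤ : Subgroup G) K) g v) = v := by
  rw [indTopTrivialMap, indLift_mk, LinearMap.id_apply]

/-- Inducing the trivial representation from the whole group gives the trivial representation. -/
noncomputable def indTopTrivialEquiv :
    (Representation.ind (⊤ : Subgroup G).subtype
      (Representation.trivial K (⊤ : Subgroup G) K)).Equiv (Representation.trivial K G K) :=
  .mk (LinearEquiv.ofLinearMap indTopTrivialMap (Representation.IndV.mk _ _ 1)
    (LinearMap.ext fun v => indTopTrivialMap_mk 1 v)
    (Representation.IndV.hom_ext _ _ fun g => LinearMap.ext fun v => by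
      change Representation.IndV.mk (⊤ : Subgroup G).subtype
        (Representation.trivial K (⊤ : Subgroup G) K) 1 (indTopTrivialMap
          (Representation.IndV.mk _ _ g v)) = Representation.IndV.mk _ _ g v
      rw [indTopTrivialMap_mk]
      have := indV_mk_mul ⊤ (Representation.trivial K (⊤ : Subgroup G) K) ⟨g, trivial⟩ 1 v
      rw [mul_one] at this
      exact this.symm))
    fun x => by
      refine Representation.IndV.hom_ext _ _ fun g => LinearMap.ext fun v => ?_
      change indTopTrivialMap (Representation.ind (⊤ : Subgroup G).subtype _ x
        (Representation.IndV.mk (⊤ : Subgroup G).subtype _ g v)) =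
        indTopTrivialMap (Representation.IndV.mk (⊤ : Subgroup G).subtype _ g v)
      rw [Representation.ind_mk, indTopTrivialMap_mk, indTopTrivialMap_mk]

/-- By the projection formula only `Ind 1 = 1` has to be checked. Restriction serves to pass between
`G` and its copy `⊤`. -/
theorem ind_top_res [Finite G] (x : CharRing K G) :
    ind ⊤ (res (⊤ : Subgroup G).subtype x) = x := by
  have h : ind (⊤ : Subgroup G) (1 : CharRing K (⊤ : Subgroup G)) = 1 := by
    rw [← repClass_trivial, ind_repClass, repClass_congr indTopTrivialEquiv, repClass_trivial]
  rw [← mul_one (res (⊤ : Subgroup G).subtype x), ind_res_mul, h, mul_one]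

theorem gammaFiltration_le_saturatedFiltration [Finite G] (n : ℕ) :
    gammaFiltration K G n ≤ saturatedFiltration K G n := fun x hx =>
  (le_iSup (fun H : Subgroup G => (gammaFiltration K H n).map (ind H)) ⊤)
    ⟨_, res_mem_gammaFiltration _ hx, ind_top_res x⟩

open Classical in
/-- The projection of an induced representation to the representation that it is induced from. -/
noncomputable def indProj (ρ : Representation K H V) : Representation.IndV H.subtype ρ →ₗ[K] V :=
  -- For `g ∈ H` the symbol of `v` at `g` equals that of `g⁻¹ v` at `1`; the other cosets are sent
  -- to zero.
  indLift H ρ (fun g => if hg : g ∈ H then ρ (⟨g, hg⟩ : H)⁻¹ else 0) fun h g v => by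
    by_cases hg : g ∈ H
    · rw [dif_pos hg, dif_pos (H.mul_mem h.2 hg), ← Module.End.mul_apply, ← map_mul]
      congr 2
      ext
      simp
    · rw [dif_neg hg, dif_neg (fun h' => hg ((H.mul_mem_cancel_left h.2).1 h'))]
      simp

theorem indProj_mk_one (ρ : Representation K H V) (v : V) :
    indProj H ρ (Representation.IndV.mk H.subtype ρ 1 v) = v := by
  rw [indProj, indLift_mk, dif_pos H.one_mem]
  have : (⟨1, H.one_mem⟩ : H)⁻¹ = 1 := by ext; simp
  rw [this, map_one, Module.End.one_apply]

theorem indProj_ind (ρ : Representation K H V) (h : H) (x : Representation.IndV H.subtype ρ) :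
    indProj H ρ (Representation.ind H.subtype ρ h x) = ρ h (indProj H ρ x) := by
  suffices indProj H ρ ∘ₗ Representation.ind H.subtype ρ h = ρ h ∘ₗ indProj H ρ from
    LinearMap.congr_fun this x
  refine Representation.IndV.hom_ext _ _ fun g => LinearMap.ext fun v => ?_
  change indProj H ρ (Representation.ind H.subtype ρ h (Representation.IndV.mk _ _ g v)) =
    ρ h (indProj H ρ (Representation.IndV.mk _ _ g v))
  rw [Representation.ind_mk, indProj, indLift_mk, indLift_mk]
  by_cases hg : g ∈ H
  · rw [dif_pos hg, dif_pos (H.mul_mem hg (H.inv_mem h.2)), ← Module.End.mul_apply, ← map_mul]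
    congr 2
    ext
    simp
  · rw [dif_neg hg, dif_neg (fun h' => hg ((H.mul_mem_cancel_right (H.inv_mem h.2)).1 h'))]
    simp

/-- A representation with an equivariant retraction onto `ρ` splits off `ρ`. -/
theorem exists_repClass_eq_add_of_retraction {W : Type w'} [AddCommGroup W] [Module K W]
    [Module.Finite K V] [Module.Finite K W] (ρ : Representation K G V) (σ : Representation K G W)
    (i : ρ.IntertwiningMap σ) (r : σ.IntertwiningMap ρ) (h : ∀ v, r (i v) = v) :
    ∃ U : FDRep K G, repClass σ = repClass ρ + repClass (rep U) := by
  -- The complement is the kernel of the retraction, by `x = i (r x) + (x - i (r x))`; no averaging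
  -- is needed.
  let N := LinearMap.ker r.toLinearMap
  have hN : ∀ g, ∀ x ∈ N, σ g x ∈ N := fun g x hx => by
    have hx' : r x = 0 := hx
    change r (σ g x) = 0
    rw [r.isIntertwining, hx', map_zero]
  let τ : Representation K G N :=
    { toFun := fun g => (σ g).restrict (hN g)
      map_one' := by ext; simp
      map_mul' := fun _ _ => by ext; simp }
  refine ⟨FDRep.of (coordRep τ), ?_⟩
  change _ = _ + repClass (coordRep τ)
  rw [← repClass_congr (coordEquiv τ), ← repClass_prod]
  refine (repClass_congr (.mk (LinearEquiv.ofBijective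
    (i.toLinearMap.coprod N.subtype) ⟨?_, ?_⟩) ?_)).symm
  · rw [← LinearMap.ker_eq_bot, LinearMap.ker_eq_bot']
    rintro ⟨v, n, hn⟩ hv
    have hn' : r n = 0 := hn
    change i v + n = 0 at hv
    have h1 := congrArg r hv
    rw [map_add, h, hn', add_zero, map_zero] at h1
    subst h1
    rw [map_zero, zero_add] at hv
    subst hv
    rfl
  · intro x
    refine ⟨(r x, ⟨x - i (r x), ?_⟩), ?_⟩
    · change r (x - i (r x)) = 0
      rw [map_sub, h, sub_self]
    · change i (r x) + (x - i (r x)) = x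
      abel
  · intro g
    refine LinearMap.ext fun x => ?_
    change i (ρ g x.1) + σ g x.2 = σ g (i x.1 + x.2)
    rw [map_add, i.isIntertwining]

/-- The coset `H` itself carries a copy of `V`, and `indProj` is an `H`-equivariant retraction onto
it. -/
theorem exists_res_ind_eq_add [Finite G] (V : FDRep K H) :
    ∃ W : FDRep K H, res H.subtype (ind H (repClass (rep V))) = repClass (rep V) + repClass (rep W) := by
  rw [ind_repClass, res_repClass]
  refine exists_repClass_eq_add_of_retraction _ _
    ⟨Representation.IndV.mk H.subtype (rep V) 1, fun h => LinearMap.ext fun v => ?_⟩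
    ⟨indProj H (rep V), fun h => LinearMap.ext fun x => indProj_ind H (rep V) h x⟩
    (indProj_mk_one H (rep V))
  change Representation.IndV.mk H.subtype (rep V) 1 (rep V h v) =
    Representation.ind H.subtype (rep V) h (Representation.IndV.mk H.subtype (rep V) 1 v)
  have := indV_mk_mul H (rep V) h (h : G)⁻¹ v
  rw [mul_inv_cancel] at this
  rw [this, Representation.ind_mk, one_mul]

end induced

/-! ### Finite generation of `R(G)` by simple modules -/

section generators

variable {K : Type u} [Field K] {G : Type v} [Group G]

theorem ofModule'_apply {M : Type*} [AddCommMonoid M] [Module K M] [Module (MonoidAlgebra K G) M]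
    [IsScalarTower K (MonoidAlgebra K G) M] (g : G) (x : M) :
    Representation.ofModule' (k := K) (G := G) M g x = MonoidAlgebra.single g (1 : K) • x := by
  simp [Representation.ofModule']

instance [Finite G] (S : Submodule (MonoidAlgebra K G) (MonoidAlgebra K G)) : Module.Finite K S :=
  Module.Finite.of_injective (S.subtype.restrictScalars K) S.subtype_injective

instance [Finite G] {V : Type*} [AddCommGroup V] [Module K V] [Module.Finite K V]
    (ρ : Representation K G V) : Module.Finite (MonoidAlgebra K G) ρ.asModule :=
  Module.Finite.of_restrictScalars_finite K _ _

theorem linearEquiv_of_isotypicComponent_eq {R : Type*} [Ring R] {M : Type*} [AddCommGroup M]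
    [Module R M] (S T : Submodule R M) [IsSimpleModule R S] [IsSimpleModule R T]
    (h : isotypicComponent R M S = isotypicComponent R M T) : Nonempty (S ≃ₗ[R] T) := by
  have : ∀ m : {m : Submodule R M | Nonempty (m ≃ₗ[R] T)}, IsSimpleModule R m :=
    fun m => .congr m.2.some
  obtain ⟨m, ⟨e⟩, ⟨f⟩⟩ := S.linearEquiv_of_le_sSup _ (S.le_isotypicComponent.trans h.le)
  exact ⟨f.trans e⟩

variable (K G) in
/-- In characteristic zero, the classes of finitely many representations generate `R_K(G)`. -/
theorem exists_finite_generators [CharZero K] [Finite G] : ∃ T : Set (FDRep K G), T.Finite ∧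
    AddSubgroup.closure ((fun V => repClass (rep V)) '' T) = ⊤ := by
  let A := MonoidAlgebra K G
  -- This is the hypothesis of Maschke's theorem, which makes `A` semisimple.
  have : NeZero (Nat.card G : K) := ⟨Nat.cast_ne_zero.2 Nat.card_pos.ne'⟩
  have hA : Module.Finite K A := inferInstance
  have : IsNoetherianRing A := isNoetherian_of_tower K inferInstance
  -- One simple left ideal is chosen in each isotypic component of the regular module; there are
  -- finitely many components.
  choose S hS hcS using fun c : isotypicComponents A A => c.2
  let F : isotypicComponents A A → FDRep K G := fun c =>
    FDRep.of (coordRep (Representation.ofModule' (k := K) (G := G) (S c)))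
  have hF : ∀ c, repClass (rep (F c)) =
      repClass (Representation.ofModule' (k := K) (G := G) (S c)) := fun c =>
    (repClass_congr (coordEquiv _)).symm
  refine ⟨Set.range F, Set.finite_range F, ?_⟩
  rw [eq_top_iff]
  intro x _
  induction x using CharRing.induction with
  | hneg x hx => exact neg_mem (hx trivial)
  | hadd x y hx hy => exact add_mem (hx trivial) (hy trivial)
  | hrep V =>
    -- `V` is a finite sum of simple modules, and each of them is isomorphic to a left ideal, hence
    -- to one of the chosen ones.
    obtain ⟨n, N, e, hN⟩ := IsSemisimpleModule.exists_linearEquiv_fin_dfinsupp A (rep V).asModule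
    have h : ∀ i, ∃ c, Nonempty (N i ≃ₗ[A] S c) := fun i => by
      obtain ⟨I, ⟨f⟩⟩ := IsSemisimpleRing.exists_linearEquiv_ideal_of_isSimpleModule A (N i)
      have : IsSimpleModule A I := .congr f.symm
      let c : isotypicComponents A A := ⟨isotypicComponent A A I, I, this, rfl⟩
      exact ⟨c, ⟨f.trans (linearEquiv_of_isotypicComponent_eq I (S c) (hcS c)).some⟩⟩
    choose c hc using h
    let e' : (rep V).asModule ≃ₗ[A] ∀ i, S (c i) :=
      (e.trans (DFinsupp.linearEquivFunOnFintype)).trans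
        (LinearEquiv.piCongrRight fun i => (hc i).some)
    have : repClass (rep V) = ∑ i, repClass (rep (F (c i))) := by
      simp only [hF]
      rw [← repClass_piRep]
      refine repClass_congr (.mk ((rep V).asModuleEquiv.symm.trans (e'.restrictScalars K)) ?_)
      intro g
      refine LinearMap.ext fun x => ?_
      change e' ((rep V).asModuleEquiv.symm (rep V g x)) =
        piRep (fun i => Representation.ofModule' (k := K) (G := G) (S (c i))) g
          (e' ((rep V).asModuleEquiv.symm x))
      rw [Representation.asModuleEquiv_symm_map_rho, map_smul]
      funext i
      exact (ofModule'_apply (K := K) g (e' ((rep V).asModuleEquiv.symm x) i)).symm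
    rw [this]
    exact sum_mem fun i _ => AddSubgroup.subset_closure ⟨_, ⟨_, rfl⟩, rfl⟩

end generators

/-! ### The augmentation ideal of `R(H)` modulo restrictions from `G`, and continuity of induction
-/

section nilpotence

open Polynomial in
/-- If a product of polynomials with constant coefficient `1` is `(1 + X) ^ m` over a domain, then
each factor is a power of `1 + X`. -/
theorem exists_eq_one_add_X_pow {D : Type*} [CommRing D] [IsDomain D] {p q : D[X]} {m : ℕ}
    (hp : p.coeff 0 = 1) (h : p * q = (1 + X) ^ m) : ∃ e, p = (1 + X) ^ e := by
  have hprime : Prime (1 + X : D[X]) := by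
    have := prime_X_sub_C (-1 : D)
    rwa [map_neg, map_one, sub_neg_eq_add, add_comm] at this
  -- A divisor of a power of the prime `1 + X` is a power of it up to a unit; that unit is a
  -- constant, and the constant coefficients force it to be `1`.
  obtain ⟨e, -, u, hu⟩ := (dvd_prime_pow hprime m).1 (Dvd.intro _ h)
  obtain ⟨c, -, hc⟩ := isUnit_iff.1 u.isUnit
  refine ⟨e, ?_⟩
  have h0 := congrArg (coeff · 0) hu
  simp only [← hc, coeff_mul_C, hp, one_mul] at h0
  rw [coeff_one_add_X_pow, Nat.choose_zero_right, Nat.cast_one] at h0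
  rw [← hu, ← hc, h0, map_one, mul_one]

variable {K : Type u} [Field K] {G : Type v} [Group G]

/-- The polynomial `∑ₙ φ(λⁿ(V)) Xⁿ`. -/
noncomputable def lambdaPoly {D : Type*} [CommRing D] (φ : CharRing K G →+* D) (V : FDRep K G) :
    Polynomial D :=
  (PowerSeries.map φ (lambdaPS (repClass (rep V)))).trunc (Module.finrank K V + 1)

theorem coe_lambdaPoly {D : Type*} [CommRing D] (φ : CharRing K G →+* D) (V : FDRep K G) :
    (lambdaPoly φ V : PowerSeries D) = PowerSeries.map φ (lambdaPS (repClass (rep V))) := by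
  ext n
  rw [Polynomial.coeff_coe, lambdaPoly, PowerSeries.coeff_trunc]
  split_ifs with h
  · rfl
  · rw [PowerSeries.coeff_map, coeff_lambdaPS, lambdaOp_repClass_eq_zero _ (by omega), map_zero]

theorem natDegree_lambdaPoly_le {D : Type*} [CommRing D] (φ : CharRing K G →+* D) (V : FDRep K G) :
    (lambdaPoly φ V).natDegree ≤ Module.finrank K V :=
  Nat.lt_succ_iff.1 (PowerSeries.natDegree_trunc_lt _ _)

theorem coeff_lambdaPoly {D : Type*} [CommRing D] (φ : CharRing K G →+* D) (V : FDRep K G) (n : ℕ) :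
    (lambdaPoly φ V).coeff n = φ (lambdaOp n (repClass (rep V))) := by
  rw [← Polynomial.coeff_coe, coe_lambdaPoly, PowerSeries.coeff_map, coeff_lambdaPS]

/-- A homomorphism to a domain under which the `λ`-polynomial of `V ⊕ W` becomes a power of `1 + X`
sends the class of `V` to its degree. -/
theorem map_repClass_eq_finrank {D : Type*} [CommRing D] [IsDomain D] (φ : CharRing K G →+* D)
    (V W : FDRep K G) (h : PowerSeries.map φ (lambdaPS (repClass (rep V) + repClass (rep W))) =
      (1 + PowerSeries.X) ^ (Module.finrank K V + Module.finrank K W)) :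
    φ (repClass (rep V)) = Module.finrank K V := by
  have hpq : lambdaPoly φ V * lambdaPoly φ W =
      (1 + Polynomial.X) ^ (Module.finrank K V + Module.finrank K W) := by
    apply Polynomial.coe_injective
    rw [Polynomial.coe_mul, coe_lambdaPoly, coe_lambdaPoly, ← map_mul, ← lambdaPS_add, h]
    simp
  have h0 : ∀ U : FDRep K G, (lambdaPoly φ U).coeff 0 = 1 := fun U => by
    rw [coeff_lambdaPoly, lambdaOp_zero, map_one]
  have hdeg : ∀ e : ℕ, ((1 + Polynomial.X : Polynomial D) ^ e).natDegree = e := fun e => by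
    rw [add_comm, ← Polynomial.C_1, Polynomial.natDegree_pow_X_add_C]
  obtain ⟨e, he⟩ := exists_eq_one_add_X_pow (h0 V) hpq
  obtain ⟨e', he'⟩ := exists_eq_one_add_X_pow (h0 W) ((mul_comm _ _).trans hpq)
  -- The exponents are bounded by the degrees of `V` and `W` and have the same sum, so both bounds
  -- are equalities. The linear coefficient is then read off, with `λ¹` the identity.
  have h1 := natDegree_lambdaPoly_le φ V
  have h2 := natDegree_lambdaPoly_le φ W
  have h3 := congrArg Polynomial.natDegree hpq
  rw [he, he', ← pow_add, hdeg, hdeg] at h3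
  rw [he, hdeg] at h1
  rw [he', hdeg] at h2
  have h4 : e = Module.finrank K V := by omega
  rw [← lambdaOp_one (repClass (rep V)), ← coeff_lambdaPoly, he, Polynomial.coeff_one_add_X_pow,
    Nat.choose_one_right, h4]

variable (K) in
/-- The ideal of `R_K(H)` generated by the restrictions of the elements of augmentation zero. -/
noncomputable def resAugIdeal (H : Subgroup G) : Ideal (CharRing K H) :=
  (augIdeal K G).map (res H.subtype)

/-- Modulo the restrictions of elements of augmentation zero, a class coming from `G` equals its
degree. Applied to the exterior powers of `ρ`, this gives binomial coefficients. -/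
theorem map_lambdaPS_res_of_le_ker {H : Subgroup G} {D : Type*} [CommRing D]
    (φ : CharRing K H →+* D) (hφ : resAugIdeal K H ≤ RingHom.ker φ)
    {V : Type w} [AddCommGroup V] [Module K V] [Module.Finite K V] (ρ : Representation K G V) :
    PowerSeries.map φ (lambdaPS (res H.subtype (repClass ρ))) =
      (1 + PowerSeries.X) ^ Module.finrank K V := by
  ext n
  rw [PowerSeries.coeff_map, coeff_lambdaPS, ← res_lambdaOp, coeff_one_add_X_pow',
    lambdaOp_repClass, ← exteriorPower.finrank_eq]
  have h : repClass (extRep n ρ) - (Module.finrank K (⋀[K]^n V) : CharRing K G) ∈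
      augIdeal K G := by
    rw [RingHom.mem_ker, map_sub, augmentation_repClass, map_natCast, sub_self]
  have := hφ (Ideal.mem_map_of_mem (res H.subtype) h)
  rw [RingHom.mem_ker, map_sub, map_sub, map_natCast, map_natCast, sub_eq_zero] at this
  exact this

/-- The radical is the intersection of the primes above the ideal. Modulo such a prime,
`map_repClass_eq_finrank` applies to the decomposition of `Res Ind V` into `V` and a complement. -/
theorem repClass_sub_finrank_mem_radical [Finite G] (H : Subgroup G) (V : FDRep K H) :
    repClass (rep V) - (Module.finrank K V : CharRing K H) ∈ (resAugIdeal K H).radical := by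
  rw [Ideal.radical_eq_sInf, Submodule.mem_sInf]
  rintro P ⟨hP, hPprime⟩
  obtain ⟨W, hW⟩ := exists_res_ind_eq_add H V
  have hdim : Module.finrank K (Representation.IndV H.subtype (rep V)) =
      Module.finrank K V + Module.finrank K W := by
    have := congrArg (augmentation K H) hW
    rw [augmentation_res, ind_repClass, map_add, augmentation_repClass, augmentation_repClass,
      augmentation_repClass] at this
    exact_mod_cast this
  have h := map_lambdaPS_res_of_le_ker (Ideal.Quotient.mk P) (by rwa [Ideal.mk_ker])
    (Representation.ind H.subtype (rep V))
  rw [← ind_repClass, hW, hdim] at h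
  rw [← Ideal.Quotient.eq, map_repClass_eq_finrank _ V W h, map_natCast]

/-- The map `x ↦ x - ε(x)` is additive and is the identity on the augmentation ideal, so additive
generators of the ring yield ideal generators. With finite `T` this makes the ideal finitely
generated. -/
theorem augIdeal_eq_span {T : Set (FDRep K G)}
    (hT : AddSubgroup.closure ((fun V => repClass (rep V)) '' T) = ⊤) :
    augIdeal K G = Ideal.span
      ((fun V : FDRep K G => repClass (rep V) - (Module.finrank K V : CharRing K G)) '' T) := by
  apply le_antisymm
  · intro x hx
    have key : x - (augmentation K G x : CharRing K G) ∈ Ideal.span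
        ((fun V : FDRep K G => repClass (rep V) - (Module.finrank K V : CharRing K G)) '' T) := by
      have hx' : x ∈ AddSubgroup.closure ((fun V => repClass (rep V)) '' T) :=
        hT ▸ AddSubgroup.mem_top x
      clear hx
      induction hx' using AddSubgroup.closure_induction with
      | mem x hx =>
        obtain ⟨V, hV, rfl⟩ := hx
        refine Ideal.subset_span ⟨V, hV, ?_⟩
        simp only [augmentation_repClass, Int.cast_natCast]
      | zero => rw [map_zero, Int.cast_zero, sub_zero]; exact zero_mem _
      | add x y _ _ hx hy =>
        rw [map_add, Int.cast_add, add_sub_add_comm]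
        exact add_mem hx hy
      | neg x _ hx =>
        have := neg_mem hx
        rwa [neg_sub', ← Int.cast_neg, ← map_neg] at this
    rwa [RingHom.mem_ker.1 hx, Int.cast_zero, sub_zero] at key
  · rw [Ideal.span_le]
    rintro _ ⟨V, -, rfl⟩
    rw [SetLike.mem_coe, RingHom.mem_ker, map_sub, augmentation_repClass, map_natCast, sub_self]

theorem exists_augIdeal_pow_le [CharZero K] [Finite G] (H : Subgroup G) :
    ∃ m, augIdeal K H ^ m ≤ resAugIdeal K H := by
  obtain ⟨T, hfin, hT⟩ := exists_finite_generators K H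
  refine Ideal.exists_pow_le_of_le_radical_of_fg ?_ ?_
  · rw [augIdeal_eq_span hT, Ideal.span_le]
    rintro _ ⟨V, -, rfl⟩
    exact repClass_sub_finrank_mem_radical H V
  · rw [augIdeal_eq_span hT]
    exact Submodule.fg_span (hfin.image _)

theorem exists_gammaFiltration_le_pow [CharZero K] [Finite G] (n : ℕ) :
    ∃ m, gammaFiltration K G m ≤ (augIdeal K G ^ n).toAddSubgroup := by
  obtain ⟨T, hfin, hT⟩ := exists_finite_generators K G
  obtain ⟨D, hD⟩ := (hfin.image fun V : FDRep K G => Module.finrank K V).bddAbove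
  -- `D` bounds the degrees of the generators; it is replaced by `D + 1` to be positive.
  refine ⟨(D + 1) * n, gammaFiltration_le_pow D.succ_pos ?_ n⟩
  rw [eq_top_iff, ← hT]
  refine AddSubgroup.closure_mono ?_
  rintro _ ⟨V, hV, rfl⟩
  exact ⟨V, (hD ⟨V, hV, rfl⟩).trans D.le_succ, rfl⟩

theorem ind_mem_of_mem_pow_resAugIdeal [Finite G] {H : Subgroup G} {n : ℕ} {x : CharRing K H}
    (hx : x ∈ resAugIdeal K H ^ n) : ind H x ∈ augIdeal K G ^ n := by
  rw [resAugIdeal, ← Ideal.map_pow] at hx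
  -- Induction is not `R(H)`-linear, so the span induction carries an arbitrary multiplier `a`.
  suffices ∀ a, ind H (a * x) ∈ augIdeal K G ^ n by simpa using this 1
  induction hx using Submodule.span_induction with
  | mem x hx =>
    obtain ⟨y, hy, rfl⟩ := hx
    intro a
    rw [mul_comm]
    exact ind_res_mul H y a ▸ Ideal.mul_mem_right _ _ hy
  | zero => intro a; rw [mul_zero, map_zero]; exact zero_mem _
  | add x y _ _ hx hy => intro a; rw [mul_add, map_add]; exact add_mem (hx a) (hy a)
  | smul b x _ hx => intro a; rw [smul_eq_mul, ← mul_assoc]; exact hx _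

/-- Induction maps deep steps of the Grothendieck filtration into deep steps. -/
theorem exists_map_ind_gammaFiltration_le [CharZero K] [Finite G] (H : Subgroup G) (n : ℕ) :
    ∃ m, (gammaFiltration K H m).map (ind H) ≤ gammaFiltration K G n := by
  -- With `J` generated by the restriction of `I_G`, the chain is `Γᵐ(H) ≤ I_H ^ (a n) ≤ J ^ n`, and
  -- induction carries `J ^ n` into `I_G ^ n ≤ Γⁿ(G)`.
  obtain ⟨a, ha⟩ := exists_augIdeal_pow_le (K := K) H
  obtain ⟨m, hm⟩ := exists_gammaFiltration_le_pow (K := K) (G := H) (a * n)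
  refine ⟨m, ?_⟩
  rintro _ ⟨x, hx, rfl⟩
  refine pow_augIdeal_le_gammaFiltration n (ind_mem_of_mem_pow_resAugIdeal ?_)
  have := hm hx
  rw [pow_mul] at this
  exact Ideal.pow_right_mono ha n this

theorem exists_saturatedFiltration_le [CharZero K] [Finite G] (n : ℕ) :
    ∃ m, saturatedFiltration K G m ≤ gammaFiltration K G n := by
  choose m hm using fun H : Subgroup G => exists_map_ind_gammaFiltration_le (K := K) H n
  -- A finite group has finitely many subgroups, so one depth serves them all.
  obtain ⟨M, hM⟩ := (Set.finite_range m).bddAbove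
  refine ⟨M, iSup_le fun H => le_trans (AddSubgroup.map_mono ?_) (hm H)⟩
  exact gammaFiltration_antitone (hM ⟨H, rfl⟩)

end nilpotence

/-! ### Equality of the topologies and continuity of induction -/

section topology

theorem filtrationBasis_topology_le {A : Type*} [AddCommGroup A] {F F' : ℕ → AddSubgroup A}
    (hF : Antitone F) (hF' : Antitone F') (h : ∀ n, ∃ m, F m ≤ F' n) :
    (filtrationBasis F hF).topology ≤ (filtrationBasis F' hF').topology := by
  refine le_of_nhds_le_nhds fun x => ?_
  rw [((filtrationBasis F hF).nhds_hasBasis x).le_basis_iff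
    ((filtrationBasis F' hF').nhds_hasBasis x)]
  rintro _ ⟨n, rfl⟩
  obtain ⟨m, hm⟩ := h n
  exact ⟨_, ⟨m, rfl⟩, Set.image_mono hm⟩

variable {K : Type u} [Field K] [CharZero K] {G : Type v} [Group G] [Finite G]

theorem gammaTopology_eq_saturatedTopology : gammaTopology K G = saturatedTopology K G :=
  le_antisymm
    (filtrationBasis_topology_le _ _ fun n => ⟨n, gammaFiltration_le_saturatedFiltration n⟩)
    (filtrationBasis_topology_le _ _ exists_saturatedFiltration_le)

theorem continuous_ind (H : Subgroup G) : Continuous (ind H : CharRing K H → CharRing K G) := by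
  refine continuous_of_continuousAt_zero (ind H) ?_
  rw [ContinuousAt, map_zero, hasBasis_nhds_zero.tendsto_iff hasBasis_nhds_zero]
  intro n _
  obtain ⟨m, hm⟩ := exists_map_ind_gammaFiltration_le (K := K) H n
  exact ⟨m, trivial, fun x hx => hm ⟨x, hx, rfl⟩⟩

end topology

end VirtualChar

theorem mainTheorem4 {K : Type u} [Field K] [CharZero K] {G : Type v} [Group G] [Finite G] :
    gammaTopology K G = saturatedTopology K G ∧
    ∀ H : Subgroup G, Continuous (ind H : CharRing K H → CharRing K G) ∧
      ∃! indHat : CompletedCharRing K H →+ CompletedCharRing K G, Continuous indHat ∧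
        ∀ x : CharRing K H, indHat (x : CompletedCharRing K H) = (ind H x : CharRing K G) := by
  refine ⟨gammaTopology_eq_saturatedTopology, fun H => ⟨continuous_ind H,
    (ind H).completion (continuous_ind H),
    ⟨AddMonoidHom.continuous_completion _ (continuous_ind H),
      AddMonoidHom.completion_coe _ (continuous_ind H)⟩, ?_⟩⟩
  rintro f ⟨hf, hfx⟩
  -- Uniqueness: two continuous maps into a Hausdorff completion that agree on the dense image of
  -- `R(H)` coincide.
  refine DFunLike.coe_injective (UniformSpace.Completion.ext hf
    (AddMonoidHom.continuous_completion _ (continuous_ind H)) fun x => ?_)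
  rw [hfx]
  exact (AddMonoidHom.completion_coe _ (continuous_ind H) x).symm
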